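/- **Setting.** Let $d\in\{1,2\}$, $h>0$, and let $l_1(r)=(h^2+r^2)^{-\alpha/2}$ with $\alpha>1$ if $d=1$ and $\alpha>2$ if $d=2$. Base stations (BSs) of density $\lambda>0$ are placed in $\mathbb R^d$ in one of two ways. * *Regular network.* For $d=1$ the BSs are the points $\Upsilon i$, $i\in\mathbb Z$, with $\Upsilon=1/\lambda$. For $d=2$ they are the points $\bigl(\Upsilon(m+\tfrac n2),\,\Upsilon n\tfrac{\sqrt3}{2}\bigr)$, $m,n\in\mathbb Z$, with $\Upsilon=\sqrt{2/(\lambda\sqrt3)}$. The typical user $u$ is uniformly distributed in the Voronoi cell of the BS at the origin, which serves it. * *Irregular network.* The BSs form a homogeneous Poisson point process of intensity $\lambda$ on $\mathbb R^d$. The typical user $u$ is at the origin and is served by the nearest BS. The channel gains $g_x$ of the BSs $x$ are i.i.d. exponential random variables with mean $1/\mu$, $\mu>0$ (Rayleigh fading), independent of the locations of the BSs and of the user. The receiver noise power is a constant $\sigma^2\ge 0$. If $b$ denotes the serving BS, put $$\mathrm{SINR}=\frac{g_b\,l_1(\|b-u\|)}{\sum_{x\ne b}g_x\,l_1(\|x-u\|)+\sigma^2},\qquad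 \tau(\lambda,\alpha)=\mathbb E\bigl[\log_2(1+\mathrm{SINR})\bigr].$$ The average area spectral efficiency is $\lambda\,\tau(\lambda,\alpha)$. **Theorem.** For each $d\in\{1,2\}$, $h>0$ and $\alpha>d$ there is a real number $L=L(d,h,\alpha)\neq 0$ such that, for all $\mu>0$ and $\sigma^2\ge0$, for the regular as well as for the irregular network, $\tau(\lambda,\alpha)$ is a finite expectation for every $\lambda>0$ and $$\lim_{\lambda\to\infty}\lambda\,\tau(\lambda,\alpha)=L .$$ Moreover, $$L\ \ge\ \frac{1}{2\ln 2\; h\left(1+\frac{\Gamma(\alpha-1)}{\Gamma(\alpha)}\right)}\quad(d=1),\qquad L\ \ge\ \frac{2\sqrt3}{12\ln 2\; h^2\left(1+2\,\frac{\Gamma(\alpha-2)}{\Gamma(\alpha-1)}\right)}\quad(d=2).$$ -/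

import Mathlib

open MeasureTheory ProbabilityTheory Filter Topology
open scoped ENNReal

noncomputable section

/-- The antenna-height path loss `l₁(r) = (h² + r²)^(-α/2)`. -/
def pathLoss (h α r : ℝ) : ℝ := (h ^ 2 + r ^ 2) ^ (-α / 2)

/-- Interference power at a user at `u` served by base station `b`, for base stations at `x i` with
channel gains `g i`: the total power received from all base stations other than `b`. -/
def interference {ι E : Type*} [MetricSpace E] (h α : ℝ) (x : ι → E) (u : E) (b : ι)
    (g : ι → ℝ) : ℝ :=
  ∑' i : {i : ι // i ≠ b}, g i * pathLoss h α (dist (x i) u)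

/-- Signal to interference plus noise ratio at a user at `u` served by base station `b`,
with noise power `σ²`. -/
def sinr {ι E : Type*} [MetricSpace E] (h α σ : ℝ) (x : ι → E) (u : E) (b : ι)
    (g : ι → ℝ) : ℝ :=
  g b * pathLoss h α (dist (x b) u) / (interference h α x u b g + σ ^ 2)

/-- Rayleigh fading: the (power) gains `G i` are i.i.d. exponential with rate `μ`, i.e. with mean
`1 / μ`, the common transmit power. -/
structure IsRayleighFading {ι Ω : Type*} [MeasurableSpace Ω] (P : Measure Ω)
    (G : ι → Ω → ℝ) (μ : ℝ) : Prop where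
  measurable : ∀ i, Measurable (G i)
  hasLaw : ∀ i, HasLaw (G i) (expMeasure μ) P
  indep : iIndepFun G P

/-- The set of user locations for which `b` is a nearest base station. -/
def voronoiCell {ι E : Type*} [MetricSpace E] (x : ι → E) (b : ι) : Set E :=
  {u | ∀ i, dist (x b) u ≤ dist (x i) u}

/-! ### Regular networks -/

/-- Base stations of the 1D regular network of density `lam` (inter-site distance `1 / lam`). -/
def lineLattice (lam : ℝ) (i : ℤ) : ℝ := 1 / lam * i

/-- Inter-site distance `Υ = √(2 / (lam √3))` of the hexagonal network of density `lam`. -/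
def hexDistance (lam : ℝ) : ℝ := √(2 / (lam * √3))

/-- Base stations of the 2D hexagonal network of density `lam`: the points
`(Υ (m + n / 2), Υ n √3 / 2)`. -/
def hexLattice (lam : ℝ) (p : ℤ × ℤ) : EuclideanSpace ℝ (Fin 2) :=
  !₂[hexDistance lam * (p.1 + p.2 / 2), hexDistance lam * (p.2 * √3 / 2)]

/-- Deterministic base stations at `x i`; the typical user `U` is uniformly distributed in the
Voronoi cell of its serving base station `b`, and the Rayleigh fading is independent of `U`. -/
structure IsRegularNetwork {ι E Ω : Type*} [MetricSpace E] [MeasureSpace E] [MeasurableSpace Ω]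
    (P : Measure Ω) (x : ι → E) (b : ι) (U : Ω → E) (G : ι → Ω → ℝ) (μ : ℝ) : Prop where
  measurable_user : Measurable U
  uniform_user : pdf.IsUniform U (voronoiCell x b) P volume
  fading : IsRayleighFading P G μ
  indep : IndepFun U (fun ω i => G i ω) P

/-- SINR of the typical user `U` of a regular network, served by base station `b`. -/
def regularSINR {ι E Ω : Type*} [MetricSpace E] (h α σ : ℝ) (x : ι → E) (b : ι)
    (U : Ω → E) (G : ι → Ω → ℝ) (ω : Ω) : ℝ :=
  sinr h α σ x (U ω) b (fun i => G i ω)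

/-! ### Irregular (Poisson) networks -/

/-- Number of points of the configuration `X 0 ω, X 1 ω, …` (with multiplicity) that lie in `A`. -/
def pointCount {E Ω : Type*} (X : ℕ → Ω → E) (A : Set E) (ω : Ω) : ℝ≥0∞ :=
  ∑' n, A.indicator (fun _ => 1) (X n ω)

/-- The points `X 0, X 1, …` form a homogeneous Poisson point process of intensity `lam`: the number
of points in a set `A` of finite volume is Poisson distributed with mean `lam * vol A`, and the
numbers of points in pairwise disjoint sets are independent. -/
structure IsPoissonPointProcess {E Ω : Type*} [MeasureSpace E] [MeasurableSpace Ω]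
    (P : Measure Ω) (X : ℕ → Ω → E) (lam : ℝ) : Prop where
  measurable : ∀ n, Measurable (X n)
  law_count : ∀ A : Set E, MeasurableSet A → volume A ≠ ∞ →
    HasLaw (pointCount X A)
      ((poissonMeasure (ENNReal.ofReal lam * volume A).toNNReal).map (Nat.cast : ℕ → ℝ≥0∞)) P
  indep_count : ∀ (k : ℕ) (A : Fin k → Set E), (∀ j, MeasurableSet (A j)) →
    Pairwise (fun i j => Disjoint (A i) (A j)) → iIndepFun (fun j => pointCount X (A j)) P

/-- Base stations form a homogeneous Poisson point process of intensity `lam`, with Rayleigh fading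
independent of their positions. -/
structure IsPoissonNetwork {E Ω : Type*} [MeasureSpace E] [MeasurableSpace Ω]
    (P : Measure Ω) (X : ℕ → Ω → E) (G : ℕ → Ω → ℝ) (lam μ : ℝ) : Prop where
  points : IsPoissonPointProcess P X lam
  fading : IsRayleighFading P G μ
  indep : IndepFun (fun ω n => X n ω) (fun ω n => G n ω) P

/-- Index of the base station nearest to `u`; in case of a tie (which has probability zero in a
Poisson network), the first of the nearest ones. -/
def nearestIndex {E : Type*} [MetricSpace E] (x : ℕ → E) (u : E) : ℕ :=
  sInf {b | u ∈ voronoiCell x b}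

/-- SINR of the typical user of a Poisson network, located at the origin and served by the nearest
base station. -/
def poissonSINR {E Ω : Type*} [MetricSpace E] [Zero E] (h α σ : ℝ)
    (X : ℕ → Ω → E) (G : ℕ → Ω → ℝ) (ω : Ω) : ℝ :=
  sinr h α σ (fun n => X n ω) 0 (nearestIndex (fun n => X n ω) 0) (fun n => G n ω)

/-! ### Average rate and area spectral efficiency -/

/-- The instantaneous rate `log₂ (1 + SINR)`. -/
def rate {Ω : Type*} (S : Ω → ℝ) (ω : Ω) : ℝ := Real.logb 2 (1 + S ω)

/-- The average ergodic rate per cell `τ = 𝔼[log₂ (1 + SINR)]`. -/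
def averageRate {Ω : Type*} [MeasurableSpace Ω] (P : Measure Ω) (S : Ω → ℝ) : ℝ :=
  ∫ ω, rate S ω ∂P

/-- For a family of networks indexed by the base station density `lam`, with SINR `S lam` on the
probability space `(Ω lam, P lam)`: the average rate `τ(lam)` is a well-defined finite expectation
for every `lam > 0`, and the average area spectral efficiency `lam * τ(lam)` converges to `L` as
`lam → ∞`. -/
def ASETendsto {Ω : ℝ → Type*} [∀ lam, MeasurableSpace (Ω lam)]
    (P : ∀ lam, Measure (Ω lam)) (S : ∀ lam, Ω lam → ℝ) (L : ℝ) : Prop :=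
  (∀ lam, 0 < lam → Integrable (rate (S lam)) (P lam)) ∧
    Tendsto (fun lam => lam * averageRate (P lam) (S lam)) atTop (𝓝 L)

end

/-!
Let `l` be the path loss, `c` the path loss of the serving station and `k = l / l(0)`.

Since the gains are exponential, `SINR > s` has, given the positions of the stations and the user,
probability `exp (-μ σ² s / c) * ∏ (1 + s l_i / c)⁻¹`, the product running over the interferers.
Integrating this against `ds / (1 + s)`, the derivative of `log (1 + s)`, supplies exactly the
factor missing from the product, that of the serving station. With `s = t / lam`, the mean of
`lam * log (1 + SINR)` is therefore the integral over `t > 0` of the spatial average of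
`exp (-rateExponent t)`, where
`rateExponent t = μ σ² t / (lam c) + ∑ i, log (1 + t l_i / (lam c))` and the sum runs over all
stations (`IsRayleighFading.lintegral_log_sinr_of_indepFun`).

As `lam → ∞`, the serving station comes arbitrarily close, so `c → l(0)`, and the sum behaves like
`t` times the integral `K` of `k`, called `totalLoss`. Hence the integral tends to
`∫ exp (-t K) dt = 1 / K`, and the area spectral efficiency to `1 / (K log 2)`, in both models.

For the upper bound, `c` is replaced by `l(0)` and the noise is dropped. In a Poisson network the
average is then given exactly by the Laplace functional
(`IsPoissonPointProcess.lintegral_exp_neg_tsum`); in a regular one the sum is compared with an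
integral by a tiling (`IsTiling.lossExponent_le_tsum_log`). Both yield the bound
`exp (-lossExponent)`, which decreases in `lam` and decays in `t` like the exponential of a negative
multiple of a power of `t` (`exists_bound_exp_neg_lossExponent`). It is used three times: it makes
every expectation finite, it dominates the limit, and its own limit is `exp (-t K)`.
For the lower bound, `c` is replaced by the path loss at a distance that tends to zero and within
which the serving station lies; in a Poisson network, up to an event of vanishing probability.
`aseTendsto_of_bounds` combines the two bounds.

The estimates for the limit follow from `k(r) ≤ min 1 ((r / h) ^ (-α))` (`totalLoss_le`).
-/

/-! ### The path loss -/

lemma pathLoss_pos {h : ℝ} (hh : 0 < h) (α r : ℝ) : 0 < pathLoss h α r := by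
  unfold pathLoss; positivity

lemma pathLoss_le_pathLoss {h α r s : ℝ} (hh : 0 < h) (hα : 0 ≤ α) (hr : 0 ≤ r) (hrs : r ≤ s) :
    pathLoss h α s ≤ pathLoss h α r := by
  unfold pathLoss
  apply Real.rpow_le_rpow_of_nonpos (by positivity) (by gcongr) (by linarith)

@[fun_prop]
lemma continuous_pathLoss {h : ℝ} (hh : 0 < h) (α : ℝ) : Continuous (pathLoss h α) := by
  unfold pathLoss
  refine Continuous.rpow_const (by fun_prop) fun x => Or.inl (by positivity)

/-- Path loss relative to that at distance zero. -/
noncomputable def relLoss (h α r : ℝ) : ℝ := pathLoss h α r / pathLoss h α 0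

section relLoss

variable {h α : ℝ}

lemma relLoss_pos (hh : 0 < h) (r : ℝ) : 0 < relLoss h α r :=
  div_pos (pathLoss_pos hh _ _) (pathLoss_pos hh _ _)

lemma relLoss_zero (hh : 0 < h) : relLoss h α 0 = 1 := div_self (pathLoss_pos hh _ _).ne'

lemma relLoss_le_relLoss {r s : ℝ} (hh : 0 < h) (hα : 0 ≤ α) (hr : 0 ≤ r) (hrs : r ≤ s) :
    relLoss h α s ≤ relLoss h α r :=
  div_le_div_of_nonneg_right (pathLoss_le_pathLoss hh hα hr hrs) (pathLoss_pos hh _ _).le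

lemma relLoss_le_one {r : ℝ} (hh : 0 < h) (hα : 0 ≤ α) (hr : 0 ≤ r) : relLoss h α r ≤ 1 :=
  (relLoss_le_relLoss hh hα le_rfl hr).trans_eq (relLoss_zero hh)

lemma continuous_relLoss (hh : 0 < h) : Continuous (relLoss h α) :=
  (continuous_pathLoss hh α).div_const _

lemma relLoss_eq (hh : 0 < h) (r : ℝ) : relLoss h α r = (1 + r ^ 2 / h ^ 2) ^ (-α / 2) := by
  unfold relLoss pathLoss
  rw [← Real.div_rpow (by positivity) (by positivity)]
  congr 1
  field_simp
  ring

/-- Power-law lower bound for the decay of the path loss. -/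
lemma exists_relLoss_lower_bound (hh : 0 < h) (hα : 0 ≤ α) {a : ℝ} (ha : 0 ≤ a) :
    ∃ c > 0, ∀ R, 1 ≤ R → c * R ^ (-α) ≤ relLoss h α (R + a) := by
  refine ⟨(1 + (1 + a) ^ 2 / h ^ 2) ^ (-α / 2), by positivity, fun R hR => ?_⟩
  rw [relLoss_eq hh]
  have e : R ^ (-α) = (R ^ 2) ^ (-α / 2) := by
    rw [← Real.rpow_natCast, ← Real.rpow_mul (by linarith)]
    congr 1; push_cast; ring
  rw [e, ← Real.mul_rpow (by positivity) (by positivity)]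
  apply Real.rpow_le_rpow_of_nonpos (by positivity) _ (by linarith)
  have h1 : (R + a) ^ 2 ≤ ((1 + a) * R) ^ 2 := by
    gcongr
    nlinarith
  have h2 : (R + a) ^ 2 / h ^ 2 ≤ ((1 + a) * R) ^ 2 / h ^ 2 := by gcongr
  have h3 : ((1 + a) * R) ^ 2 / h ^ 2 = (1 + a) ^ 2 / h ^ 2 * R ^ 2 := by ring
  nlinarith

/-- Total path loss relative to that at distance zero, `∫ l(‖y‖) / l(0) dy`. -/
noncomputable def totalLoss (E : Type*) [NormedAddCommGroup E] [MeasureSpace E] (h α : ℝ) : ℝ :=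
  ∫ y : E, relLoss h α ‖y‖

section integrals

variable {E : Type*} [NormedAddCommGroup E] [NormedSpace ℝ E] [FiniteDimensional ℝ E]
  [MeasureSpace E] [BorelSpace E] [(volume : Measure E).IsAddHaarMeasure]

/-- The path loss stays integrable when distances are shortened by a bounded amount. -/
lemma integrable_relLoss_of_le (hh : 0 < h) (hα : (Module.finrank ℝ E : ℝ) < α) {s : E → ℝ}
    (hs : Measurable s) {a : ℝ} (hsa : ∀ y, ‖y‖ ≤ s y + a) :
    Integrable (fun y : E => relLoss h α (s y)) := by
  have hα0 : 0 < α := lt_of_le_of_lt (Nat.cast_nonneg _) hα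
  -- `c` is chosen so that `c (1 + ‖y‖²) ≤ 1 + s² / h²`
  obtain ⟨c, hc, hc2⟩ : ∃ c > 0, ∀ y : E, c * (1 + ‖y‖ ^ 2) ≤ 1 + s y ^ 2 / h ^ 2 := by
    refine ⟨1 / (1 + 2 * h ^ 2 + 2 * a ^ 2), by positivity, fun y => ?_⟩
    rw [div_mul_eq_mul_div, div_le_iff₀ (by positivity), one_mul]
    have h1 : ‖y‖ ^ 2 ≤ 2 * s y ^ 2 + 2 * a ^ 2 := by
      have h2 : ‖y‖ ^ 2 ≤ (s y + a) ^ 2 := by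
        have := hsa y
        have := norm_nonneg y
        gcongr
      nlinarith [sq_nonneg (s y - a)]
    have h3 : s y ^ 2 / h ^ 2 * (2 * h ^ 2) = 2 * s y ^ 2 := by field_simp
    have h4 : 0 ≤ s y ^ 2 / h ^ 2 := by positivity
    nlinarith [mul_nonneg h4 (sq_nonneg a), sq_nonneg h]
  refine ((integrable_rpow_neg_one_add_norm_sq (μ := volume) hα).const_mul (c ^ (-α / 2))).mono'
    ((continuous_relLoss hh).measurable.comp hs).aestronglyMeasurable (ae_of_all _ fun y => ?_)
  rw [Real.norm_of_nonneg (relLoss_pos hh _).le, relLoss_eq hh,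
    ← Real.mul_rpow hc.le (by positivity)]
  exact Real.rpow_le_rpow_of_nonpos (by positivity) (hc2 y) (by linarith)

lemma integrable_relLoss (hh : 0 < h) (hα : (Module.finrank ℝ E : ℝ) < α) :
    Integrable (fun y : E => relLoss h α ‖y‖) :=
  integrable_relLoss_of_le hh hα measurable_norm (a := 0) (by simp)

lemma totalLoss_pos (hh : 0 < h) (hα : (Module.finrank ℝ E : ℝ) < α) : 0 < totalLoss E h α := by
  unfold totalLoss
  rw [integral_pos_iff_support_of_nonneg (fun y => (relLoss_pos hh _).le)
    (integrable_relLoss hh hα)]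
  have : (Function.support fun y : E => relLoss h α ‖y‖) = Set.univ := by
    ext y; simp [(relLoss_pos hh _).ne']
  rw [this]
  exact NeZero.pos _

/-- Bounding the relative path loss by `min 1 ((r / h) ^ (-α))` bounds the total loss. -/
lemma totalLoss_le (hh : 0 < h) [Nontrivial E] (hα : (Module.finrank ℝ E : ℝ) < α) :
    totalLoss E h α ≤ Module.finrank ℝ E * volume.real (Metric.ball (0 : E) 1) *
      (h ^ Module.finrank ℝ E / Module.finrank ℝ E +
        h ^ Module.finrank ℝ E / (α - Module.finrank ℝ E)) := by
  set d := Module.finrank ℝ E with hd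
  have hd0 : 0 < d := Module.finrank_pos
  have hα0 : 0 < α := lt_of_le_of_lt (Nat.cast_nonneg _) hα
  unfold totalLoss
  rw [integral_fun_norm_addHaar, nsmul_eq_mul, smul_eq_mul, mul_assoc]
  have hint := (integrable_fun_norm_addHaar (volume : Measure E)).1 (integrable_relLoss hh hα)
  simp only [smul_eq_mul] at hint ⊢
  gcongr
  rw [← Set.Ioc_union_Ioi_eq_Ioi hh.le, setIntegral_union Set.Ioc_disjoint_Ioi_same
    measurableSet_Ioi (hint.mono_set Set.Ioc_subset_Ioi_self)
    (hint.mono_set (Set.Ioi_subset_Ioi hh.le))]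
  gcongr ?_ + ?_
  · have e : ∫ y in Set.Ioc 0 h, y ^ (d - 1) = h ^ d / d := by
      rw [← intervalIntegral.integral_of_le hh.le, integral_pow]
      rw [Nat.sub_add_cancel hd0, zero_pow hd0.ne', sub_zero]
      congr 1
      push_cast [Nat.cast_sub (Nat.one_le_iff_ne_zero.2 hd0.ne')]
      ring
    rw [← e]
    refine setIntegral_mono_on (hint.mono_set Set.Ioc_subset_Ioi_self)
      (Continuous.integrableOn_Ioc (by fun_prop)) measurableSet_Ioc fun y hy => ?_
    exact mul_le_of_le_one_right (pow_nonneg hy.1.le _) (relLoss_le_one hh hα0.le hy.1.le)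
  · have hlt : (d : ℝ) - 1 - α < -1 := by linarith
    have e : ∫ y in Set.Ioi h, h ^ α * y ^ ((d : ℝ) - 1 - α) = h ^ d / (α - d) := by
      rw [integral_const_mul, integral_Ioi_rpow_of_lt hlt hh]
      have : (d : ℝ) - 1 - α + 1 = d - α := by ring
      rw [this, neg_div, ← div_neg, neg_sub, ← mul_div_assoc, ← Real.rpow_add hh]
      simp
    rw [← e]
    refine setIntegral_mono_on (hint.mono_set (Set.Ioi_subset_Ioi hh.le))
      ((integrableOn_Ioi_rpow_of_lt hlt hh).const_mul _) measurableSet_Ioi fun y hy => ?_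
    have hy0 : 0 < y := hh.trans hy
    have h1 : relLoss h α y ≤ h ^ α * y ^ (-α) := by
      rw [relLoss_eq hh]
      have : h ^ α * y ^ (-α) = (y ^ 2 / h ^ 2) ^ (-α / 2) := by
        rw [← div_pow, ← Real.rpow_natCast, ← Real.rpow_mul (by positivity),
          Real.div_rpow hy0.le hh.le]
        have : ((2 : ℕ) : ℝ) * (-α / 2) = -α := by push_cast; ring
        rw [this, Real.rpow_neg hh.le α]
        field_simp
      rw [this]
      exact Real.rpow_le_rpow_of_nonpos (by positivity) (by linarith) (by linarith)
    have h2 : y ^ ((d : ℝ) - 1 - α) = y ^ (d - 1) * y ^ (-α) := by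
      rw [← Real.rpow_natCast, ← Real.rpow_add hy0]
      congr 1
      push_cast [Nat.cast_sub (Nat.one_le_iff_ne_zero.2 hd0.ne')]
      ring
    calc y ^ (d - 1) * relLoss h α y ≤ y ^ (d - 1) * (h ^ α * y ^ (-α)) := by gcongr
      _ = _ := by rw [h2]; ring

/-- For Poisson base stations of density `lam` the Laplace transform of the relative interference is
`exp (-lossExponent)`, with `a = 0`. Increasing distances by `a` gives an upper bound for lattices:
there `a = 2 ρ` when both the user and every point of a tile lie within `ρ` of their station. -/
noncomputable def lossExponent (E : Type*) [NormedAddCommGroup E] [MeasureSpace E]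
    (h α a lam t : ℝ) : ℝ :=
  ∫ y : E, t * relLoss h α (‖y‖ + a) / (1 + t * relLoss h α (‖y‖ + a) / lam)

lemma saturation_le {x lam : ℝ} (hx : 0 ≤ x) (hlam : 0 < lam) : x / (1 + x / lam) ≤ x :=
  div_le_self hx (by have : 0 ≤ x / lam := by positivity
                     linarith)

lemma saturation_mono {x y lam lam' : ℝ} (hx : 0 ≤ x) (hxy : x ≤ y) (hlam : 0 < lam)
    (hll : lam ≤ lam') : x / (1 + x / lam) ≤ y / (1 + y / lam') := by
  have h1 : 0 ≤ x / lam := by positivity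
  have h2 : 0 ≤ y / lam' := by have := hx.trans hxy; have := hlam.trans_le hll; positivity
  rw [div_le_div_iff₀ (by linarith) (by linarith)]
  have h3 : y / lam' ≤ y / lam := by have := hx.trans hxy; gcongr
  have h4 : x * (y / lam) = y * (x / lam) := by ring
  nlinarith [mul_le_mul_of_nonneg_left h3 hx]

lemma integrable_saturation (hh : 0 < h) (hα : (Module.finrank ℝ E : ℝ) < α) {a lam t : ℝ}
    (ha : 0 ≤ a) (hlam : 0 < lam) (ht : 0 ≤ t) :
    Integrable (fun y : E =>
      t * relLoss h α (‖y‖ + a) / (1 + t * relLoss h α (‖y‖ + a) / lam)) := by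
  have hm : Measurable fun y : E => relLoss h α (‖y‖ + a) :=
    (continuous_relLoss hh).measurable.comp (by fun_prop)
  refine ((integrable_relLoss_of_le (E := E) hh hα (s := fun y => ‖y‖ + a) (a := 0) (by fun_prop)
    (fun y => by linarith)).const_mul t).mono' ?_ (ae_of_all _ fun y => ?_)
  · exact Measurable.aestronglyMeasurable (by fun_prop)
  · have := relLoss_pos (α := α) hh (‖y‖ + a)
    rw [Real.norm_of_nonneg (by positivity)]
    exact saturation_le (by positivity) hlam

lemma lossExponent_mono (hh : 0 < h) (hα : (Module.finrank ℝ E : ℝ) < α) {a a' lam lam' t : ℝ}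
    (ha : 0 ≤ a) (haa : a ≤ a') (hlam : 0 < lam') (hll : lam' ≤ lam) (ht : 0 ≤ t) :
    lossExponent E h α a' lam' t ≤ lossExponent E h α a lam t := by
  have hα0 : 0 < α := lt_of_le_of_lt (Nat.cast_nonneg _) hα
  refine integral_mono (integrable_saturation hh hα (ha.trans haa) hlam ht)
    (integrable_saturation hh hα ha (hlam.trans_le hll) ht) fun y => ?_
  refine saturation_mono (mul_nonneg ht (relLoss_pos hh _).le) ?_ hlam hll
  gcongr
  exact relLoss_le_relLoss hh hα0.le (by positivity) (by linarith)

lemma tendsto_lossExponent (hh : 0 < h) (hα : (Module.finrank ℝ E : ℝ) < α) {a : ℝ → ℝ}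
    (ha : ∀ᶠ lam in atTop, 0 ≤ a lam) (ha0 : Tendsto a atTop (𝓝 0)) {t : ℝ} (ht : 0 ≤ t) :
    Tendsto (fun lam => lossExponent E h α (a lam) lam t) atTop (𝓝 (t * totalLoss E h α)) := by
  have hα0 : 0 < α := lt_of_le_of_lt (Nat.cast_nonneg _) hα
  unfold totalLoss
  rw [← integral_const_mul]
  refine tendsto_integral_filter_of_dominated_convergence (fun y => t * relLoss h α ‖y‖)
    ?_ ?_ ((integrable_relLoss hh hα).const_mul t) (ae_of_all _ fun y => ?_)
  · filter_upwards [ha, eventually_gt_atTop 0] with lam h1 h2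
    exact (integrable_saturation hh hα h1 h2 ht).aestronglyMeasurable
  · filter_upwards [ha, eventually_gt_atTop 0] with lam h1 h2
    refine ae_of_all _ fun y => ?_
    have := relLoss_pos (α := α) hh (‖y‖ + a lam)
    rw [Real.norm_of_nonneg (by positivity)]
    refine (saturation_le (by positivity) h2).trans ?_
    gcongr
    exact relLoss_le_relLoss hh hα0.le (norm_nonneg _) (by linarith)
  · have h1 : Tendsto (fun lam => t * relLoss h α (‖y‖ + a lam)) atTop
        (𝓝 (t * relLoss h α ‖y‖)) := by
      refine Tendsto.const_mul t (((continuous_relLoss hh).tendsto _).comp ?_)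
      simpa using ha0.const_add ‖y‖
    have h2 := h1.div ((h1.div_atTop tendsto_id).const_add 1) (by simp)
    simpa [Pi.div_def] using h2

/-- The exponent grows at least like a power of `t`: the stations within distance `t ^ (1 / α)`
contribute at least a constant each. -/
lemma exists_le_lossExponent (hh : 0 < h) [Nontrivial E] (hα : (Module.finrank ℝ E : ℝ) < α)
    {a lam : ℝ} (ha : 0 ≤ a) (hlam : 0 < lam) :
    ∃ C > 0, ∀ t, 1 ≤ t →
      C * t ^ ((Module.finrank ℝ E : ℝ) / α) ≤ lossExponent E h α a lam t := by
  have hα0 : 0 < α := lt_of_le_of_lt (Nat.cast_nonneg _) hα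
  obtain ⟨c, hc, hcR⟩ := exists_relLoss_lower_bound hh hα0.le ha
  set v := volume.real (Metric.ball (0 : E) 1) with hv
  have hv0 : 0 < v :=
    ENNReal.toReal_pos (Metric.measure_ball_pos _ _ one_pos).ne' measure_ball_lt_top.ne
  refine ⟨c / (1 + c / lam) * v, by positivity, fun t ht => ?_⟩
  have ht0 : 0 < t := by linarith
  set R := t ^ (1 / α) with hR
  have hR1 : 1 ≤ R := Real.one_le_rpow ht (by positivity)
  have hRα : t * R ^ (-α) = 1 := by
    rw [hR, ← Real.rpow_mul ht0.le, show 1 / α * -α = -1 by field_simp, Real.rpow_neg_one,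
      mul_inv_cancel₀ ht0.ne']
  have hball : volume.real (Metric.ball (0 : E) R) = t ^ ((Module.finrank ℝ E : ℝ) / α) * v := by
    rw [measureReal_def, Measure.addHaar_ball _ _ (by positivity), ENNReal.toReal_mul,
      ENNReal.toReal_ofReal (by positivity), hv, measureReal_def, hR, ← Real.rpow_natCast,
      ← Real.rpow_mul ht0.le, one_div_mul_eq_div]
  have hint := integrable_saturation (E := E) hh hα ha hlam ht0.le
  calc c / (1 + c / lam) * v * t ^ ((Module.finrank ℝ E : ℝ) / α)
      = ∫ y in Metric.ball (0 : E) R, c / (1 + c / lam) := by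
        rw [setIntegral_const, hball, smul_eq_mul]; ring
    _ ≤ ∫ y in Metric.ball (0 : E) R,
          t * relLoss h α (‖y‖ + a) / (1 + t * relLoss h α (‖y‖ + a) / lam) := by
        refine setIntegral_mono_on (integrableOn_const measure_ball_lt_top.ne) hint.integrableOn
          measurableSet_ball fun y hy => saturation_mono hc.le ?_ hlam le_rfl
        calc c = t * (c * R ^ (-α)) := by rw [mul_left_comm, hRα, mul_one]
          _ ≤ t * relLoss h α (R + a) := by gcongr; exact hcR R hR1
          _ ≤ _ := by
            gcongr
            refine relLoss_le_relLoss hh hα0.le (by positivity) ?_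
            have := mem_ball_zero_iff.1 hy
            linarith
    _ ≤ lossExponent E h α a lam t := by
        refine setIntegral_le_integral hint (ae_of_all _ fun y => ?_)
        have := relLoss_pos (α := α) hh (‖y‖ + a)
        simp only [Pi.zero_apply]
        positivity

lemma exists_bound_exp_neg_lossExponent (hh : 0 < h) [Nontrivial E]
    (hα : (Module.finrank ℝ E : ℝ) < α) {a lam : ℝ} (ha : 0 ≤ a) (hlam : 0 < lam) :
    ∃ D : ℝ → ℝ≥0∞, ∫⁻ t in Set.Ioi 0, D t ≠ ∞ ∧
      ∀ t, 0 < t → ENNReal.ofReal (Real.exp (-lossExponent E h α a lam t)) ≤ D t := by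
  have hα0 : 0 < α := lt_of_le_of_lt (Nat.cast_nonneg _) hα
  obtain ⟨C, hC, hCt⟩ := exists_le_lossExponent (E := E) hh hα ha hlam
  set p := (Module.finrank ℝ E : ℝ) / α with hp
  have hp0 : 0 < p := div_pos (Nat.cast_pos.2 Module.finrank_pos) hα0
  -- The factor `exp C` makes the bound at least `1` on `t ≤ 1`, where the exponent is only known to
  -- be nonnegative.
  refine ⟨fun t => ENNReal.ofReal (Real.exp C * Real.exp (-C * t ^ p)), ?_, fun t ht => ?_⟩
  · have h1 := (integrableOn_rpow_mul_exp_neg_mul_rpow (s := 0) (by norm_num) hp0 hC).const_mul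
      (Real.exp C)
    simp only [Real.rpow_zero, one_mul] at h1
    exact h1.lintegral_lt_top.ne
  · simp only [← Real.exp_add]
    refine ENNReal.ofReal_le_ofReal (Real.exp_le_exp.2 ?_)
    rcases le_total 1 t with h1 | h1
    · linarith [hCt t h1]
    · have h2 : t ^ p ≤ 1 := Real.rpow_le_one ht.le h1 hp0.le
      have h3 : 0 ≤ lossExponent E h α a lam t := by
        refine integral_nonneg fun y => ?_
        have := relLoss_pos (α := α) hh (‖y‖ + a)
        simp only [Pi.zero_apply]
        positivity
      nlinarith

/-- If the spatial average `A lam t` in the rate formula lies between `exp (-t * M lam) - ε lam` and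
the exponential of `-lossExponent`, the area spectral efficiency converges. -/
theorem aseTendsto_of_bounds (hh : 0 < h) [Nontrivial E] (hα : (Module.finrank ℝ E : ℝ) < α)
    {Ω : ℝ → Type*} [∀ lam, MeasurableSpace (Ω lam)] {P : ∀ lam, Measure (Ω lam)}
    {S : ∀ lam, Ω lam → ℝ} {A : ℝ → ℝ → ℝ≥0∞} {a M ε : ℝ → ℝ}
    (hS : ∀ lam, 0 < lam → AEMeasurable (S lam) (P lam))
    (hS0 : ∀ lam, 0 < lam → ∀ᵐ ω ∂P lam, 0 ≤ S lam ω)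
    (hA : ∀ lam, 0 < lam → ∫⁻ ω, ENNReal.ofReal (lam * Real.log (1 + S lam ω)) ∂P lam =
      ∫⁻ t in Set.Ioi 0, A lam t)
    (hAm : ∀ lam, 0 < lam → Measurable (A lam))
    (ha0 : ∀ lam, 0 < lam → 0 ≤ a lam) (ha_anti : AntitoneOn a (Set.Ioi 0))
    (ha : Tendsto a atTop (𝓝 0))
    (upper : ∀ lam t, 0 < lam → 0 < t →
      A lam t ≤ ENNReal.ofReal (Real.exp (-lossExponent E h α (a lam) lam t)))
    (lower : ∀ lam t, 0 < lam → 0 < t →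
      ENNReal.ofReal (Real.exp (-(t * M lam)) - ε lam) ≤ A lam t)
    (hM : Tendsto M atTop (𝓝 (totalLoss E h α))) (hε : Tendsto ε atTop (𝓝 0)) :
    ASETendsto P S (1 / (totalLoss E h α * Real.log 2)) := by
  set K := totalLoss E h α with hK
  have hK0 : 0 < K := totalLoss_pos hh hα
  have hlog : 0 < Real.log 2 := Real.log_pos one_lt_two
  have hbound : ∀ lam₀, 0 < lam₀ → ∃ D : ℝ → ℝ≥0∞, ∫⁻ t in Set.Ioi 0, D t ≠ ∞ ∧
      ∀ lam t, lam₀ ≤ lam → 0 < t → A lam t ≤ D t := by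
    intro lam₀ h₀
    obtain ⟨D, hD, hDt⟩ := exists_bound_exp_neg_lossExponent (E := E) hh hα (ha0 _ h₀) h₀
    refine ⟨D, hD, fun lam t hl ht => ((upper lam t (h₀.trans_le hl) ht).trans ?_).trans (hDt t ht)⟩
    have hl0 := h₀.trans_le hl
    exact ENNReal.ofReal_le_ofReal (Real.exp_le_exp.2 (neg_le_neg
      (lossExponent_mono hh hα (ha0 _ hl0) (ha_anti h₀ hl0 hl) h₀ hl ht.le)))
  have hfin : ∀ lam, 0 < lam → ∫⁻ t in Set.Ioi 0, A lam t ≠ ∞ := by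
    intro lam hl
    obtain ⟨D, hD, hDt⟩ := hbound lam hl
    exact ne_top_of_le_ne_top hD
      (setLIntegral_mono' measurableSet_Ioi fun t ht => hDt lam t le_rfl ht)
  have hlogm : ∀ lam, 0 < lam → AEMeasurable (fun ω => Real.log (1 + S lam ω)) (P lam) :=
    fun lam hl => ((hS lam hl).const_add 1).log
  have hlog0 : ∀ lam, 0 < lam → ∀ᵐ ω ∂P lam, 0 ≤ Real.log (1 + S lam ω) := fun lam hl =>
    (hS0 lam hl).mono fun ω hω => Real.log_nonneg (by linarith)
  have hmain : Tendsto (fun lam => ∫⁻ t in Set.Ioi 0, A lam t) atTop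
      (𝓝 (ENNReal.ofReal (1 / K))) := by
    have e : ENNReal.ofReal (1 / K) = ∫⁻ t in Set.Ioi 0, ENNReal.ofReal (Real.exp (-(t * K))) := by
      have hi : IntegrableOn (fun t => Real.exp (-(t * K))) (Set.Ioi 0) := by
        simpa [mul_comm] using integrableOn_exp_mul_Ioi (neg_lt_zero.2 hK0) 0
      rw [← ofReal_integral_eq_lintegral_ofReal hi (ae_of_all _ fun t => (Real.exp_pos _).le)]
      have := integral_exp_mul_Ioi (neg_lt_zero.2 hK0) 0
      congr 1
      simp only [mul_comm _ K, ← neg_mul, this]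
      simp
    rw [e]
    obtain ⟨D, hD, hDt⟩ := hbound 1 one_pos
    refine tendsto_lintegral_filter_of_dominated_convergence D ?_ ?_ hD ?_
    · filter_upwards [eventually_gt_atTop 0] with lam hl using hAm lam hl
    · filter_upwards [eventually_ge_atTop 1] with lam hl
      exact (ae_restrict_iff' measurableSet_Ioi).2 (ae_of_all _ fun t ht => hDt lam t hl ht)
    · refine (ae_restrict_iff' measurableSet_Ioi).2 (ae_of_all _ fun t ht => ?_)
      have ht : 0 < t := ht
      refine tendsto_of_tendsto_of_tendsto_of_le_of_le' (g := fun lam =>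
        ENNReal.ofReal (Real.exp (-(t * M lam)) - ε lam)) (h := fun lam =>
        ENNReal.ofReal (Real.exp (-lossExponent E h α (a lam) lam t))) ?_ ?_ ?_ ?_
      · refine ENNReal.tendsto_ofReal ?_
        have := ((Real.continuous_exp.tendsto _).comp (hM.const_mul t).neg).sub hε
        simpa using this
      · refine ENNReal.tendsto_ofReal ((Real.continuous_exp.tendsto _).comp ?_)
        exact (tendsto_lossExponent hh hα
          ((eventually_gt_atTop 0).mono fun lam hl => ha0 lam hl) ha ht.le).neg
      · filter_upwards [eventually_gt_atTop 0] with lam hl using lower lam t hl ht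
      · filter_upwards [eventually_gt_atTop 0] with lam hl using upper lam t hl ht
  constructor
  · intro lam hl
    have h1 : Integrable (fun ω => lam * Real.log (1 + S lam ω)) (P lam) := by
      refine ⟨((hlogm lam hl).const_mul lam).aestronglyMeasurable, ?_⟩
      rw [hasFiniteIntegral_iff_ofReal
        ((hlog0 lam hl).mono fun ω hω => mul_nonneg hl.le hω), hA lam hl]
      exact (hfin lam hl).lt_top
    have h2 := h1.const_mul (lam⁻¹ / Real.log 2)
    refine h2.congr (ae_of_all _ fun ω => ?_)
    simp only [rate, Real.logb]
    field_simp
  · have h1 := ((ENNReal.tendsto_toReal ENNReal.ofReal_ne_top).comp hmain).div_const (Real.log 2)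
    rw [ENNReal.toReal_ofReal (by positivity), div_div] at h1
    refine h1.congr' ?_
    filter_upwards [eventually_gt_atTop 0] with lam hl
    simp only [Function.comp, ← hA lam hl, averageRate, rate, Real.logb]
    rw [← integral_eq_lintegral_of_nonneg_ae
      ((hlog0 lam hl).mono fun ω hω => mul_nonneg hl.le hω)
      ((hlogm lam hl).const_mul lam).aestronglyMeasurable, integral_const_mul, integral_div,
      mul_div_assoc]

end integrals
end relLoss

/-! ### Rayleigh fading at fixed positions -/

lemma expMeasure_Ioi {μ : ℝ} (hμ : 0 < μ) {y : ℝ} (hy : 0 ≤ y) :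
    expMeasure μ (Set.Ioi y) = ENNReal.ofReal (Real.exp (-(μ * y))) := by
  have := isProbabilityMeasure_expMeasure hμ
  have h1 := cdf_expMeasure_eq hμ y
  rw [if_pos hy, cdf_eq_real] at h1
  rw [← Set.compl_Iic, ← ofReal_measureReal, probReal_compl_eq_one_sub measurableSet_Iic, h1]
  simp

lemma expMeasure_Iic_zero {μ : ℝ} (hμ : 0 < μ) : expMeasure μ (Set.Iic 0) = 0 := by
  have := isProbabilityMeasure_expMeasure hμ
  have h1 := cdf_expMeasure_eq hμ 0
  rw [if_pos le_rfl, cdf_eq_real] at h1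
  rw [← ofReal_measureReal, h1]
  simp

/-- The moment generating function of the exponential distribution, by recognising the tilted
density as another exponential density. -/
lemma lintegral_exp_neg_expMeasure {μ a : ℝ} (hμ : 0 < μ) (ha : 0 < μ + a) :
    ∫⁻ x, ENNReal.ofReal (Real.exp (-(a * x))) ∂(expMeasure μ) =
      ENNReal.ofReal (μ / (μ + a)) := by
  have hm : ∀ r, Measurable (exponentialPDF r) := fun r =>
    (measurable_exponentialPDFReal r).ennreal_ofReal
  have h0 : expMeasure μ = volume.withDensity (exponentialPDF μ) := rfl
  rw [h0, lintegral_withDensity_eq_lintegral_mul _ (hm μ) (by fun_prop)]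
  have h1 : ∀ x, (exponentialPDF μ * fun x => ENNReal.ofReal (Real.exp (-(a * x)))) x =
      ENNReal.ofReal (μ / (μ + a)) * exponentialPDF (μ + a) x := by
    intro x
    simp only [Pi.mul_apply, exponentialPDF_eq]
    rw [← ENNReal.ofReal_mul (by split_ifs <;> positivity), ← ENNReal.ofReal_mul (by positivity)]
    congr 1
    split_ifs
    · rw [mul_assoc, ← Real.exp_add, ← mul_assoc, div_mul_cancel₀ _ ha.ne']
      congr 2; ring
    · simp
  rw [lintegral_congr h1, lintegral_const_mul _ (hm _), lintegral_exponentialPDF_eq_one ha, mul_one]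

lemma lintegral_id_expMeasure_ne_top {μ : ℝ} (hμ : 0 < μ) :
    ∫⁻ x, ENNReal.ofReal x ∂(expMeasure μ) ≠ ∞ := by
  -- `x ≤ (2 / μ) exp (μ x / 2)` reduces finiteness of the mean to the moment generating function.
  have h1 : ∀ x : ℝ, ENNReal.ofReal x ≤
      ENNReal.ofReal (2 / μ) * ENNReal.ofReal (Real.exp (-(-(μ / 2) * x))) := by
    intro x
    rw [← ENNReal.ofReal_mul (by positivity)]
    refine ENNReal.ofReal_le_ofReal ?_
    have h2 := Real.add_one_le_exp (-(-(μ / 2) * x))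
    calc x = 2 / μ * (-(-(μ / 2) * x)) := by field_simp
      _ ≤ _ := by gcongr; linarith
  refine ne_top_of_le_ne_top ?_ (lintegral_mono h1)
  rw [lintegral_const_mul _ (by fun_prop), lintegral_exp_neg_expMeasure hμ (by linarith)]
  exact ENNReal.mul_ne_top ENNReal.ofReal_ne_top ENNReal.ofReal_ne_top

section fading

variable {ι Ω : Type*} [MeasurableSpace Ω] {P : Measure Ω} {G : ι → Ω → ℝ} {μ : ℝ}

lemma IsRayleighFading.isProbabilityMeasure (hG : IsRayleighFading P G μ) :
    IsProbabilityMeasure P := hG.indep.isProbabilityMeasure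

lemma IsRayleighFading.ae_pos [Countable ι] (hμ : 0 < μ) (hG : IsRayleighFading P G μ) :
    ∀ᵐ ω ∂P, ∀ i, 0 < G i ω := by
  refine ae_all_iff.2 fun i => ?_
  rw [ae_iff]
  simp only [not_lt]
  exact ((hG.hasLaw i).measure_eq (p := fun x => x ≤ 0) measurableSet_Iic).trans
    (expMeasure_Iic_zero hμ)

lemma IsRayleighFading.precomp {κ : Type*} {f : κ → ι} (hf : f.Injective)
    (hG : IsRayleighFading P G μ) : IsRayleighFading P (fun k => G (f k)) μ :=
  ⟨fun _ => hG.measurable _, fun _ => hG.hasLaw _, hG.indep.precomp hf⟩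

/-- The fading of one station is independent of that of all the others together. -/
lemma IsRayleighFading.indepFun_compl (hG : IsRayleighFading P G μ) (b : ι) :
    IndepFun (G b) (fun ω (i : {i : ι // i ≠ b}) => G i ω) P := by
  have h1 := indep_iSup_of_disjoint (fun i => (hG.measurable i).comap_le) hG.indep
    (S := {b}) (T := {b}ᶜ) (by simp)
  refine (indep_of_indep_of_le_left (indep_of_indep_of_le_right h1 ?_) ?_)
  · rw [MeasurableSpace.pi, MeasurableSpace.comap_iSup]
    refine iSup_le fun i => ?_
    rw [MeasurableSpace.comap_comp]
    exact le_iSup₂_of_le (i : ι) (by simpa using i.2) le_rfl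
  · exact le_iSup₂_of_le b rfl le_rfl

/-- An exponential variable exceeds an independent nonnegative variable `Y` with probability
`𝔼 exp (-μ Y)`. -/
lemma measure_lt_of_indepFun_exp [IsProbabilityMeasure P] (hμ : 0 < μ) {X Y : Ω → ℝ}
    (hX : Measurable X) (hY : Measurable Y) (hXμ : HasLaw X (expMeasure μ) P)
    (hXY : IndepFun X Y P) (hY0 : ∀ᵐ ω ∂P, 0 ≤ Y ω) :
    P {ω | Y ω < X ω} = ∫⁻ ω, ENNReal.ofReal (Real.exp (-(μ * Y ω))) ∂P := by
  have := isProbabilityMeasure_expMeasure hμ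
  have h1 := (indepFun_iff_map_prod_eq_prod_map_map hY.aemeasurable hX.aemeasurable).1 hXY.symm
  have hms : MeasurableSet {p : ℝ × ℝ | p.1 < p.2} := measurableSet_lt measurable_fst measurable_snd
  have h2 : P {ω | Y ω < X ω} = (P.map fun ω => (Y ω, X ω)) {p : ℝ × ℝ | p.1 < p.2} := by
    rw [Measure.map_apply (by fun_prop) hms]; rfl
  have := Measure.isProbabilityMeasure_map (μ := P) hY.aemeasurable
  rw [h2, h1, hXμ.map_eq, Measure.prod_apply hms,
    lintegral_map (measurable_measure_prodMk_left hms) hY]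
  refine lintegral_congr_ae ?_
  filter_upwards [hY0] with ω hω
  exact expMeasure_Ioi hμ hω

variable [Countable ι]

lemma IsRayleighFading.ae_summable (hμ : 0 < μ) (hG : IsRayleighFading P G μ) {w : ι → ℝ}
    (hw : ∀ i, 0 ≤ w i) (hs : Summable w) : ∀ᵐ ω ∂P, Summable fun i => G i ω * w i := by
  have hm := hG.measurable
  have h1 : ∫⁻ ω, ∑' i, ENNReal.ofReal (G i ω) * ENNReal.ofReal (w i) ∂P ≠ ∞ := by
    rw [lintegral_tsum fun i => by fun_prop]
    have h2 : ∀ i, ∫⁻ ω, ENNReal.ofReal (G i ω) * ENNReal.ofReal (w i) ∂P =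
        (∫⁻ x, ENNReal.ofReal x ∂(expMeasure μ)) * ENNReal.ofReal (w i) := by
      intro i
      rw [lintegral_mul_const _ (by fun_prop), (hG.hasLaw i).lintegral_comp (by fun_prop)]
    simp_rw [h2]
    rw [ENNReal.tsum_mul_left]
    exact ENNReal.mul_ne_top (lintegral_id_expMeasure_ne_top hμ) hs.tsum_ofReal_ne_top
  filter_upwards [ae_lt_top' (by fun_prop) h1, hG.ae_pos hμ] with ω h2 h3
  have h4 := ENNReal.summable_toReal h2.ne
  refine h4.congr fun i => ?_
  rw [ENNReal.toReal_mul, ENNReal.toReal_ofReal (h3 i).le, ENNReal.toReal_ofReal (hw i)]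

/-- Laplace transform of a weighted sum of independent exponential gains. -/
lemma IsRayleighFading.lintegral_exp_neg_tsum (hμ : 0 < μ) (hG : IsRayleighFading P G μ)
    {w : ι → ℝ} (hw : ∀ i, 0 ≤ w i) (hs : Summable w) :
    ∫⁻ ω, ENNReal.ofReal (Real.exp (-∑' i, G i ω * w i)) ∂P =
      ENNReal.ofReal (Real.exp (-∑' i, Real.log (1 + w i / μ))) := by
  have := hG.isProbabilityMeasure
  have hm := hG.measurable
  have hfin : ∀ s : Finset ι, ∫⁻ ω, ENNReal.ofReal (Real.exp (-∑ i ∈ s, G i ω * w i)) ∂P =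
      ENNReal.ofReal (Real.exp (-∑ i ∈ s, Real.log (1 + w i / μ))) := by
    intro s
    have h1 : ∀ ω, ENNReal.ofReal (Real.exp (-∑ i ∈ s, G i ω * w i)) =
        ∏ i ∈ s, ENNReal.ofReal (Real.exp (-(w i * G i ω))) := by
      intro ω
      rw [← ENNReal.ofReal_prod_of_nonneg fun i _ => (Real.exp_pos _).le, ← Real.exp_sum,
        Finset.sum_neg_distrib]
      simp only [mul_comm]
    simp_rw [h1]
    rw [lintegral_prod_eq_prod_lintegral_of_indepFun s
      (fun i ω => ENNReal.ofReal (Real.exp (-(w i * G i ω)))) ?_ (fun i => by fun_prop)]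
    · rw [← Finset.sum_neg_distrib, Real.exp_sum,
        ENNReal.ofReal_prod_of_nonneg fun i _ => (Real.exp_pos _).le]
      refine Finset.prod_congr rfl fun i _ => ?_
      have h2 := hw i
      rw [(hG.hasLaw i).lintegral_comp (f := fun x => ENNReal.ofReal (Real.exp (-(w i * x))))
        (by fun_prop), lintegral_exp_neg_expMeasure hμ (by linarith), Real.exp_neg,
        Real.exp_log (by positivity)]
      congr 1
      field_simp
    · exact hG.indep.comp (fun i x => ENNReal.ofReal (Real.exp (-(w i * x))))
        fun i => by fun_prop
  have hlim1 : Tendsto (fun s : Finset ι =>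
      ∫⁻ ω, ENNReal.ofReal (Real.exp (-∑ i ∈ s, G i ω * w i)) ∂P) atTop
      (𝓝 (∫⁻ ω, ENNReal.ofReal (Real.exp (-∑' i, G i ω * w i)) ∂P)) := by
    refine tendsto_lintegral_filter_of_dominated_convergence (fun _ => 1)
      (Eventually.of_forall fun s => by fun_prop) (Eventually.of_forall fun s => ?_) (by simp) ?_
    · filter_upwards [hG.ae_pos hμ] with ω h0
      rw [ENNReal.ofReal_le_one, Real.exp_le_one_iff, neg_nonpos]
      exact Finset.sum_nonneg fun i _ => mul_nonneg (h0 i).le (hw i)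
    · filter_upwards [hG.ae_summable hμ hw hs] with ω h1
      exact ENNReal.tendsto_ofReal ((Real.continuous_exp.tendsto _).comp (Tendsto.neg h1.hasSum))
  refine tendsto_nhds_unique hlim1 ?_
  simp_rw [hfin]
  have h1 : Summable fun i => Real.log (1 + w i / μ) :=
    Real.summable_log_one_add_of_summable (hs.div_const μ)
  exact ENNReal.tendsto_ofReal ((Real.continuous_exp.tendsto _).comp (Tendsto.neg h1.hasSum))

/-- The exponent in the rate formula: when the path losses `l i` and the serving station `b` are
fixed, `lam * log (1 + SINR)` has mean `∫ exp (-rateExponent t) dt` over `t > 0`. The sum runs over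
all stations, the term of the serving one accounting for the derivative of the logarithm. -/
noncomputable def rateExponent (σ μ lam : ℝ) (l : ι → ℝ) (b : ι) (t : ℝ) : ℝ :=
  μ * σ ^ 2 * (t / lam) / l b + ∑' i, Real.log (1 + t / lam * (l i / l b))

lemma integral_one_div_one_add_div {lam y : ℝ} (hlam : 0 < lam) (hy : 0 ≤ y) :
    ∫ t in 0..lam * y, 1 / (1 + t / lam) = lam * Real.log (1 + y) := by
  have hpos : ∀ t ∈ Set.uIcc 0 (lam * y), 0 < 1 + t / lam := by
    intro t ht
    rw [Set.uIcc_of_le (by positivity)] at ht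
    have := div_nonneg ht.1 hlam.le
    linarith
  rw [intervalIntegral.integral_eq_sub_of_hasDerivAt (f := fun t => lam * Real.log (1 + t / lam))]
  · simp [mul_div_cancel_left₀ _ hlam.ne']
  · intro t ht
    have h1 : HasDerivAt (fun t => 1 + t / lam) (1 / lam) t :=
      ((hasDerivAt_id t).div_const lam).const_add 1
    have := (h1.log (hpos t ht).ne').const_mul lam
    convert! this using 1
    field_simp
  · exact ContinuousOn.intervalIntegrable
      (continuousOn_const.div (by fun_prop) fun t ht => (hpos t ht).ne')

/-- Mean rate of a user served by `b` when the path losses are fixed. -/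
theorem IsRayleighFading.lintegral_log_sinr [Nontrivial ι] (hμ : 0 < μ)
    (hG : IsRayleighFading P G μ) {l : ι → ℝ} (hl : ∀ i, 0 < l i) (hs : Summable l) (b : ι)
    (σ : ℝ) {lam : ℝ} (hlam : 0 < lam) :
    ∫⁻ ω, ENNReal.ofReal (lam * Real.log (1 + G b ω * l b /
      ((∑' i : {i : ι // i ≠ b}, G i ω * l i) + σ ^ 2))) ∂P =
      ∫⁻ t in Set.Ioi 0, ENNReal.ofReal (Real.exp (-rateExponent σ μ lam l b t)) := by
  have := hG.isProbabilityMeasure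
  have hm := hG.measurable
  have hG' := hG.precomp (Subtype.val_injective (p := fun i => i ≠ b))
  set I : ({i : ι // i ≠ b} → ℝ) → ℝ := fun g => ∑' i, g i * l i with hI
  have hIm : Measurable I := Measurable.tsum fun i => by fun_prop
  set IG : Ω → ℝ := fun ω => I fun i => G i ω with hIG
  have hIGm : Measurable IG := hIm.comp (by fun_prop)
  -- The interference is positive, so the SINR is an honest quotient even when `σ = 0`.
  have hIpos : ∀ᵐ ω ∂P, 0 < IG ω := by
    obtain ⟨i, hi⟩ := exists_ne b
    filter_upwards [hG.ae_pos hμ, hG'.ae_summable hμ (fun i => (hl i).le)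
      (hs.comp_injective Subtype.val_injective)] with ω h1 h2
    exact h2.tsum_pos (fun j => mul_nonneg (h1 j).le (hl j).le) ⟨i, hi⟩ (mul_pos (h1 i) (hl i))
  set S : Ω → ℝ := fun ω => lam * (G b ω * l b / (IG ω + σ ^ 2)) with hS
  have hSm : Measurable S := by fun_prop
  have hS0 : ∀ᵐ ω ∂P, 0 ≤ S ω := by
    filter_upwards [hIpos, hG.ae_pos hμ] with ω h1 h2
    have := h2 b
    have := hl b
    positivity
  -- Layer cake formula for `lam * log (1 + y)`, whose derivative in `t = lam * y` is
  -- `1 / (1 + t / lam)`.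
  have hcake := lintegral_comp_eq_lintegral_meas_lt_mul P (f := S) (g := fun t => 1 / (1 + t / lam))
    hS0 hSm.aemeasurable ?_ ?_
  · have e : ∫⁻ ω, ENNReal.ofReal (lam * Real.log (1 + G b ω * l b / (IG ω + σ ^ 2))) ∂P =
        ∫⁻ ω, ENNReal.ofReal (∫ t in 0..S ω, 1 / (1 + t / lam)) ∂P := by
      refine lintegral_congr_ae ?_
      filter_upwards [hS0] with ω h1
      rw [hS, integral_one_div_one_add_div hlam (nonneg_of_mul_nonneg_right h1 hlam)]
    refine (e.trans hcake).trans (setLIntegral_congr_fun measurableSet_Ioi fun t ht => ?_)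
    have ht : 0 < t := ht
    have hlb := hl b
    set θ := t / lam / l b with hθ
    have hθ0 : 0 < θ := by positivity
    have h1 : P {ω | t < S ω} = P {ω | θ * (IG ω + σ ^ 2) < G b ω} := by
      refine measure_congr ?_
      filter_upwards [hIpos] with ω h1
      refine propext ?_
      change t < lam * (G b ω * l b / (IG ω + σ ^ 2)) ↔ t / lam / l b * (IG ω + σ ^ 2) < G b ω
      rw [← div_lt_iff₀' hlam, lt_div_iff₀ (by positivity), div_mul_eq_mul_div (t / lam),
        div_lt_iff₀ hlb]
    have hind : IndepFun (G b) (fun ω => θ * (IG ω + σ ^ 2)) P :=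
      (hG.indepFun_compl b).comp (φ := id) (ψ := fun g => θ * (I g + σ ^ 2)) measurable_id
        (by fun_prop)
    rw [h1, measure_lt_of_indepFun_exp hμ (hm b) (by fun_prop) (hG.hasLaw b) hind
      (hIpos.mono fun ω h => by positivity)]
    have hw : ∀ i : {i : ι // i ≠ b}, 0 ≤ μ * θ * l i := fun i => by have := hl i; positivity
    have hws : Summable fun i : {i : ι // i ≠ b} => μ * θ * l i :=
      (hs.comp_injective Subtype.val_injective).mul_left _
    have h2 : ∀ ω, ENNReal.ofReal (Real.exp (-(μ * (θ * (IG ω + σ ^ 2))))) =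
        ENNReal.ofReal (Real.exp (-(μ * θ * σ ^ 2))) *
          ENNReal.ofReal (Real.exp (-∑' i : {i : ι // i ≠ b}, G i ω * (μ * θ * l i))) := by
      intro ω
      rw [← ENNReal.ofReal_mul (Real.exp_pos _).le, ← Real.exp_add]
      have : ∑' i : {i : ι // i ≠ b}, G i ω * (μ * θ * l i) = μ * θ * IG ω := by
        rw [hIG, hI, ← tsum_mul_left]
        exact tsum_congr fun i => by ring
      rw [this]
      congr 2; ring
    simp_rw [h2]
    rw [lintegral_const_mul _ (by
      have : Measurable fun ω => ∑' i : {i : ι // i ≠ b}, G i ω * (μ * θ * l i) :=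
        Measurable.tsum fun i => by fun_prop
      fun_prop), hG'.lintegral_exp_neg_tsum hμ hw hws, ← ENNReal.ofReal_mul (Real.exp_pos _).le,
      ← ENNReal.ofReal_mul (by positivity)]
    congr 1
    have hsum : Summable fun i => Real.log (1 + t / lam * (l i / l b)) :=
      Real.summable_log_one_add_of_summable ((hs.div_const _).mul_left _)
    -- The serving station's term of the full sum is `log (1 + t / lam)`, cancelling the weight.
    have hsplit : ∑' i, Real.log (1 + t / lam * (l i / l b)) =
        Real.log (1 + t / lam) + ∑' i : {i : ι // i ≠ b}, Real.log (1 + μ * θ * l i / μ) := by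
      rw [← hsum.tsum_subtype_add_tsum_subtype_compl {b}]
      congr 1
      · rw [tsum_singleton b fun i => Real.log (1 + t / lam * (l i / l b)), div_self hlb.ne',
          mul_one]
      · refine tsum_congr fun i => ?_
        rw [hθ]
        congr 2
        field_simp
    have hlt : 0 < t / lam := by positivity
    rw [rateExponent, hsplit, neg_add, neg_add, Real.exp_add, Real.exp_add,
      Real.exp_neg (Real.log _), Real.exp_log (by linarith)]
    have : μ * σ ^ 2 * (t / lam) / l b = μ * θ * σ ^ 2 := by rw [hθ]; ring
    rw [this]
    ring
  · intro t ht
    refine ContinuousOn.intervalIntegrable (continuousOn_const.div (by fun_prop) fun s hs => ?_)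
    rw [Set.uIcc_of_le ht.le] at hs
    have := div_nonneg hs.1 hlam.le
    linarith
  · refine (ae_restrict_iff' measurableSet_Ioi).2 (ae_of_all _ fun t ht => ?_)
    have : 0 < t / lam := div_pos ht hlam
    change 0 ≤ 1 / (1 + t / lam)
    positivity

/-! ### Rayleigh fading at random positions -/

section random

variable {T : Type*} [MeasurableSpace T] {l : T → ι → ℝ} {b : T → ι} [MeasurableSpace ι]
  [MeasurableSingletonClass ι]

lemma measurable_sinr_of_loss (hl : ∀ i, Measurable fun w => l w i) (hb : Measurable b) (σ : ℝ) :
    Measurable fun p : T × (ι → ℝ) => p.2 (b p.1) * l p.1 (b p.1) /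
      ((∑' i : {i : ι // i ≠ b p.1}, p.2 i * l p.1 i) + σ ^ 2) := by
  have h1 : Measurable fun q : ι × T × (ι → ℝ) => q.2.2 q.1 * l q.2.1 q.1 /
      ((∑' i : {i : ι // i ≠ q.1}, q.2.2 i * l q.2.1 i) + σ ^ 2) := by
    refine measurable_from_prod_countable_right fun j => ?_
    have : Measurable fun p : T × (ι → ℝ) => ∑' i : {i : ι // i ≠ j}, p.2 i * l p.1 i :=
      Measurable.tsum fun i => by fun_prop
    have h2 : Measurable fun p : T × (ι → ℝ) => p.2 j := by fun_prop
    exact (h2.mul ((hl j).comp measurable_fst)).div (this.add_const _)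
  exact h1.comp ((hb.comp measurable_fst).prodMk measurable_id)

lemma measurable_rateExponent (hl : ∀ i, Measurable fun w => l w i) (hb : Measurable b)
    (σ μ lam : ℝ) : Measurable fun p : T × ℝ => rateExponent σ μ lam (l p.1) (b p.1) p.2 := by
  have h1 : Measurable fun q : ι × T × ℝ => rateExponent σ μ lam (l q.2.1) q.1 q.2.2 := by
    refine measurable_from_prod_countable_right fun j => ?_
    have : Measurable fun p : T × ℝ => ∑' i, Real.log (1 + p.2 / lam * (l p.1 i / l p.1 j)) :=
      Measurable.tsum fun i => by fun_prop
    exact Measurable.add (Measurable.div (by fun_prop) ((hl j).comp measurable_fst)) this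
  exact h1.comp ((hb.comp measurable_fst).prodMk measurable_id)

/-- Mean rate when path losses and serving station depend on randomness `W` that is independent of
the fading. -/
theorem IsRayleighFading.lintegral_log_sinr_of_indepFun [Nontrivial ι] (hμ : 0 < μ)
    (hG : IsRayleighFading P G μ) {W : Ω → T} (hW : Measurable W)
    (hWG : IndepFun W (fun ω i => G i ω) P) (hl : ∀ i, Measurable fun w => l w i)
    (hl0 : ∀ w i, 0 < l w i) (hb : Measurable b) (hs : ∀ᵐ ω ∂P, Summable (l (W ω)))
    (σ : ℝ) {lam : ℝ} (hlam : 0 < lam) :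
    ∫⁻ ω, ENNReal.ofReal (lam * Real.log (1 + G (b (W ω)) ω * l (W ω) (b (W ω)) /
      ((∑' i : {i : ι // i ≠ b (W ω)}, G i ω * l (W ω) i) + σ ^ 2))) ∂P =
      ∫⁻ t in Set.Ioi 0, ∫⁻ ω, ENNReal.ofReal
        (Real.exp (-rateExponent σ μ lam (l (W ω)) (b (W ω)) t)) ∂P := by
  have := hG.isProbabilityMeasure
  have hm := hG.measurable
  have hGm : Measurable fun ω i => G i ω := by fun_prop
  have hmap := (indepFun_iff_map_prod_eq_prod_map_map hW.aemeasurable hGm.aemeasurable).1 hWG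
  have hF := measurable_sinr_of_loss hl hb σ
  have hF' : Measurable fun p : T × (ι → ℝ) => ENNReal.ofReal (lam * Real.log (1 +
      p.2 (b p.1) * l p.1 (b p.1) / ((∑' i : {i : ι // i ≠ b p.1}, p.2 i * l p.1 i) + σ ^ 2))) :=
    (((hF.const_add 1).log).const_mul lam).ennreal_ofReal
  have h1 := lintegral_map (μ := P) hF' (hW.prodMk hGm)
  have := Measure.isProbabilityMeasure_map (μ := P) hGm.aemeasurable
  have := Measure.isProbabilityMeasure_map (μ := P) hW.aemeasurable
  rw [← h1, hmap, lintegral_prod _ hF'.aemeasurable, lintegral_map hF'.lintegral_prod_right' hW]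
  have hR := measurable_rateExponent hl hb σ μ lam
  rw [lintegral_lintegral_swap (μ := volume.restrict (Set.Ioi 0))]
  · refine lintegral_congr_ae ?_
    filter_upwards [hs] with ω hω
    exact (lintegral_map (hF'.comp (measurable_prodMk_left (x := W ω))) hGm).trans
      (hG.lintegral_log_sinr hμ (hl0 _) hω (b (W ω)) σ hlam)
  · exact Measurable.aemeasurable (Measurable.ennreal_ofReal (Real.measurable_exp.comp
      ((hR.comp ((hW.comp measurable_snd).prodMk measurable_fst)).neg)))

end random

end fading

/-! ### Poisson point processes -/

open scoped NNReal in
lemma lintegral_poissonMeasure (r : ℝ≥0) (f : ℕ → ℝ≥0∞) :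
    ∫⁻ n, f n ∂(poissonMeasure r) =
      ∑' n : ℕ, ENNReal.ofReal (Real.exp (-r) * r ^ n / n.factorial) * f n := by
  rw [poissonMeasure, lintegral_sum_measure]
  simp

open scoped NNReal in
lemma lintegral_cast_poissonMeasure (r : ℝ≥0) :
    ∫⁻ n, (n : ℝ≥0∞) ∂(poissonMeasure r) = r := by
  rw [lintegral_poissonMeasure, tsum_eq_zero_add' ENNReal.summable]
  simp only [Nat.cast_zero, mul_zero, zero_add]
  have h1 : ∀ n : ℕ, ENNReal.ofReal (Real.exp (-r) * r ^ (n + 1) / (n + 1).factorial) *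
      ((n + 1 : ℕ) : ℝ≥0∞) = r * ENNReal.ofReal (Real.exp (-r) * r ^ n / n.factorial) := by
    intro n
    rw [← ENNReal.ofReal_natCast (n + 1), ← ENNReal.ofReal_coe_nnreal,
      ← ENNReal.ofReal_mul (by positivity), ← ENNReal.ofReal_mul (by positivity)]
    congr 1
    rw [Nat.factorial_succ]
    push_cast
    field_simp
    ring
  simp_rw [h1]
  rw [ENNReal.tsum_mul_left]
  have h2 := (hasSum_one_poissonMeasure r)
  rw [← ENNReal.ofReal_tsum_of_nonneg (fun n => by positivity) h2.summable, h2.tsum_eq]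
  simp

open scoped NNReal in
/-- Laplace transform of the Poisson distribution. -/
lemma lintegral_exp_neg_poissonMeasure (r : ℝ≥0) (a : ℝ) :
    ∫⁻ n, ENNReal.ofReal (Real.exp (-(a * (n : ℕ)))) ∂(poissonMeasure r) =
      ENNReal.ofReal (Real.exp (-(r * (1 - Real.exp (-a))))) := by
  rw [lintegral_poissonMeasure]
  have h1 : ∀ n : ℕ, ENNReal.ofReal (Real.exp (-r) * r ^ n / n.factorial) *
      ENNReal.ofReal (Real.exp (-(a * n))) =
      ENNReal.ofReal (Real.exp (-r) * ((r * Real.exp (-a)) ^ n / n.factorial)) := by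
    intro n
    rw [← ENNReal.ofReal_mul (by positivity)]
    congr 1
    rw [mul_pow, ← Real.exp_nat_mul, mul_neg, mul_comm a]
    ring
  simp_rw [h1]
  have h2 : HasSum (fun n : ℕ => Real.exp (-r) * ((r * Real.exp (-a)) ^ n / n.factorial))
      (Real.exp (-r) * Real.exp (r * Real.exp (-a))) := by
    refine HasSum.mul_left _ ?_
    rw [Real.exp_eq_exp_ℝ]
    exact NormedSpace.expSeries_div_hasSum_exp _
  rw [← ENNReal.ofReal_tsum_of_nonneg (fun n => by positivity) h2.summable, h2.tsum_eq,
    ← Real.exp_add]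
  congr 2
  ring

section poisson

variable {E Ω : Type*} [MeasureSpace E] [MeasurableSpace Ω] {P : Measure Ω} {X : ℕ → Ω → E}
  {lam : ℝ}

@[fun_prop]
lemma measurable_pointCount (hX : ∀ n, Measurable (X n)) {A : Set E} (hA : MeasurableSet A) :
    Measurable (pointCount X A) := by
  unfold pointCount
  exact Measurable.tsum fun n => (measurable_const.indicator hA).comp (hX n)

lemma IsPoissonPointProcess.lintegral_comp_pointCount (hX : IsPoissonPointProcess P X lam)
    {A : Set E} (hA : MeasurableSet A) (hvol : volume A ≠ ∞) {f : ℝ≥0∞ → ℝ≥0∞}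
    (hf : Measurable f) : ∫⁻ ω, f (pointCount X A ω) ∂P =
      ∫⁻ n, f ((n : ℕ) : ℝ≥0∞) ∂(poissonMeasure (ENNReal.ofReal lam * volume A).toNNReal) := by
  rw [(hX.law_count A hA hvol).lintegral_comp hf.aemeasurable, lintegral_map hf .of_discrete]

lemma IsPoissonPointProcess.lintegral_pointCount (hX : IsPoissonPointProcess P X lam)
    {A : Set E} (hA : MeasurableSet A) (hvol : volume A ≠ ∞) :
    ∫⁻ ω, pointCount X A ω ∂P = ENNReal.ofReal lam * volume A := by
  rw [hX.lintegral_comp_pointCount hA hvol (f := fun x => x) measurable_id,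
    lintegral_cast_poissonMeasure,
    ENNReal.coe_toNNReal (ENNReal.mul_ne_top ENNReal.ofReal_ne_top hvol)]

/-- Campbell's formula. -/
lemma IsPoissonPointProcess.lintegral_tsum [SigmaFinite (volume : Measure E)]
    (hX : IsPoissonPointProcess P X lam) {f : E → ℝ≥0∞} (hf : Measurable f) :
    ∫⁻ ω, ∑' n, f (X n ω) ∂P = ENNReal.ofReal lam * ∫⁻ y, f y := by
  have hXm := hX.measurable
  -- The mean measure agrees with `lam • volume` on sets of finite volume, hence everywhere.
  have h1 : Measure.sum (fun n => P.map (X n)) = ENNReal.ofReal lam • volume := by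
    rw [Measure.ext_iff_of_iUnion_eq_univ (iUnion_spanningSets (volume : Measure E))]
    intro i
    ext A hA
    have hAi := hA.inter (measurableSet_spanningSets (volume : Measure E) i)
    rw [Measure.restrict_apply hA, Measure.restrict_apply hA, Measure.smul_apply, smul_eq_mul,
      ← hX.lintegral_pointCount hAi (measure_ne_top_of_subset Set.inter_subset_right
        (measure_spanningSets_lt_top _ i).ne), Measure.sum_apply _ hAi]
    unfold pointCount
    refine ((MeasureTheory.lintegral_tsum fun n =>
      ((measurable_const.indicator hAi).comp (hXm n)).aemeasurable).trans
      (tsum_congr fun n => ?_)).symm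
    change ∫⁻ ω, (A ∩ spanningSets volume i).indicator (fun _ => 1) (X n ω) ∂P = _
    rw [← lintegral_map (measurable_const.indicator hAi) (hXm n)]
    simp [hAi]
  refine (MeasureTheory.lintegral_tsum fun n => (hf.comp (hXm n)).aemeasurable).trans ?_
  have h2 : ∀ n, ∫⁻ ω, f (X n ω) ∂P = ∫⁻ y, f y ∂(P.map (X n)) := fun n =>
    (lintegral_map hf (hXm n)).symm
  simp only [Function.comp_def, h2]
  rw [← lintegral_sum_measure, h1, lintegral_smul_measure, smul_eq_mul]

lemma IsPoissonPointProcess.measure_pointCount_eq_zero (hX : IsPoissonPointProcess P X lam)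
    (hlam : 0 ≤ lam) {A : Set E} (hA : MeasurableSet A) (hvol : volume A ≠ ∞) :
    P {ω | pointCount X A ω = 0} = ENNReal.ofReal (Real.exp (-(lam * volume.real A))) := by
  have h1 : P {ω | pointCount X A ω = 0} = (poissonMeasure
      (ENNReal.ofReal lam * volume A).toNNReal).map (Nat.cast : ℕ → ℝ≥0∞) {0} :=
    (hX.law_count A hA hvol).measure_eq (p := fun x => x = 0) (measurableSet_singleton 0)
  have h2 : (Nat.cast : ℕ → ℝ≥0∞) ⁻¹' {0} = {0} := by ext n; simp
  rw [h1, Measure.map_apply .of_discrete (measurableSet_singleton (0 : ℝ≥0∞)), h2,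
    poissonMeasure_singleton]
  simp [measureReal_def, ENNReal.coe_toNNReal_eq_toReal, ENNReal.toReal_ofReal hlam]

/-- The Laplace functional on simple functions, from the independence of the counts on the level
sets. -/
lemma IsPoissonPointProcess.lintegral_exp_neg_simpleFunc [IsProbabilityMeasure P]
    (hX : IsPoissonPointProcess P X lam) (g : SimpleFunc E ℝ≥0∞) (hg : ∀ x, g x ≠ ∞)
    (hfin : ∫⁻ y, g y ≠ ∞) :
    ∫⁻ ω, ENNReal.ofReal (Real.exp (-(∑' n, g (X n ω)).toReal)) ∂P =
      ENNReal.ofReal (Real.exp (-(ENNReal.ofReal lam *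
        ∫⁻ y, ENNReal.ofReal (1 - Real.exp (-(g y).toReal))).toReal)) := by
  classical
  have hXm := hX.measurable
  -- The level set of the value `0` may have infinite volume, but does not contribute.
  set s := g.range.filter (· ≠ 0) with hs
  have hs0 : ∀ a ∈ s, a ≠ 0 := fun a ha => (Finset.mem_filter.1 ha).2
  have hst : ∀ a ∈ s, a ≠ ∞ := by
    intro a ha
    obtain ⟨x, rfl⟩ := SimpleFunc.mem_range.1 (Finset.mem_filter.1 ha).1
    exact hg x
  have hvol : ∀ a ∈ s, volume (g ⁻¹' {a}) ≠ ∞ := fun a ha =>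
    ((SimpleFunc.FinMeasSupp.of_lintegral_ne_top
      (by rwa [SimpleFunc.lintegral_eq_lintegral] at hfin)).meas_preimage_singleton_ne_zero
      (hs0 a ha)).ne
  have hmeas : ∀ a, MeasurableSet (g ⁻¹' {a}) := fun a => g.measurableSet_preimage _
  set e := s.equivFin
  have hindep := hX.indep_count s.card (fun j => g ⁻¹' {((e.symm j : s) : ℝ≥0∞)})
    (fun j => hmeas _) (fun i j hij => by
      refine Disjoint.preimage g (Set.disjoint_singleton.2 fun h => hij ?_)
      exact e.symm.injective (Subtype.ext h))
  have hsum : ∀ ω, ∑' n, g (X n ω) = ∑ j, ((e.symm j : s) : ℝ≥0∞) *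
      pointCount X (g ⁻¹' {((e.symm j : s) : ℝ≥0∞)}) ω := by
    intro ω
    have h1 : ∀ x, g x = ∑ a ∈ s, a * (g ⁻¹' {a}).indicator (fun _ => 1) x := by
      intro x
      by_cases hx : g x = 0
      · rw [hx, eq_comm]
        refine Finset.sum_eq_zero fun a ha => ?_
        rw [Set.indicator_of_notMem, mul_zero]
        intro hxa
        exact hs0 a ha (by rw [← hx]; exact hxa.symm)
      · rw [Finset.sum_eq_single (g x)]
        · simp
        · intro a _ hne
          rw [Set.indicator_of_notMem, mul_zero]
          exact fun hxa => hne hxa.symm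
        · exact fun hns => (hns (Finset.mem_filter.2 ⟨g.mem_range_self x, hx⟩)).elim
    simp_rw [h1]
    rw [Summable.tsum_finsetSum fun _ _ => ENNReal.summable]
    simp_rw [ENNReal.tsum_mul_left]
    rw [← Finset.sum_coe_sort s, ← Equiv.sum_comp e.symm]
    rfl
  have hcount : ∀ᵐ ω ∂P, ∀ j, pointCount X (g ⁻¹' {((e.symm j : s) : ℝ≥0∞)}) ω ≠ ∞ := by
    refine ae_all_iff.2 fun j => ?_
    have h1 := hX.lintegral_pointCount (hmeas _) (hvol _ (e.symm j).2)
    filter_upwards [ae_lt_top (measurable_pointCount hXm (hmeas _)) (h1.trans_ne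
      (ENNReal.mul_ne_top ENNReal.ofReal_ne_top (hvol _ (e.symm j).2)))] with ω h2 using h2.ne
  have hleft : ∀ᵐ ω ∂P, ENNReal.ofReal (Real.exp (-(∑' n, g (X n ω)).toReal)) =
      ∏ j, ENNReal.ofReal (Real.exp (-(((e.symm j : s) : ℝ≥0∞).toReal *
        (pointCount X (g ⁻¹' {((e.symm j : s) : ℝ≥0∞)}) ω).toReal))) := by
    filter_upwards [hcount] with ω hω
    rw [hsum, ENNReal.toReal_sum fun j _ => ENNReal.mul_ne_top (hst _ (e.symm j).2) (hω j),
      ← ENNReal.ofReal_prod_of_nonneg fun j _ => (Real.exp_pos _).le, ← Real.exp_sum,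
      Finset.sum_neg_distrib]
    simp_rw [ENNReal.toReal_mul]
  rw [lintegral_congr_ae hleft, lintegral_prod_eq_prod_lintegral_of_indepFun Finset.univ
    (fun j ω => ENNReal.ofReal (Real.exp (-(((e.symm j : s) : ℝ≥0∞).toReal *
        (pointCount X (g ⁻¹' {((e.symm j : s) : ℝ≥0∞)}) ω).toReal))))]
  rotate_left
  · exact hindep.comp (fun j x => ENNReal.ofReal (Real.exp
      (-(((e.symm j : s) : ℝ≥0∞).toReal * x.toReal)))) fun j => by fun_prop
  · intro j
    have := measurable_pointCount hXm (hmeas ((e.symm j : s) : ℝ≥0∞))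
    fun_prop
  have hright : ∫⁻ y, ENNReal.ofReal (1 - Real.exp (-(g y).toReal)) =
      ∑ j, ENNReal.ofReal (1 - Real.exp (-((e.symm j : s) : ℝ≥0∞).toReal)) *
        volume (g ⁻¹' {((e.symm j : s) : ℝ≥0∞)}) := by
    have h1 : ∫⁻ y, ENNReal.ofReal (1 - Real.exp (-(g y).toReal)) =
        (g.map fun x => ENNReal.ofReal (1 - Real.exp (-x.toReal))).lintegral volume := by
      rw [← SimpleFunc.lintegral_eq_lintegral]; rfl
    rw [h1, SimpleFunc.map_lintegral, Equiv.sum_comp e.symm fun a : s =>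
      ENNReal.ofReal (1 - Real.exp (-(a : ℝ≥0∞).toReal)) * volume (g ⁻¹' {(a : ℝ≥0∞)}),
      Finset.sum_coe_sort s fun a => ENNReal.ofReal (1 - Real.exp (-a.toReal)) *
        volume (g ⁻¹' {a}), hs, Finset.sum_filter_of_ne]
    intro a _ hne h0
    simp [h0] at hne
  rw [hright, Finset.mul_sum, ENNReal.toReal_sum, ← Finset.sum_neg_distrib, Real.exp_sum,
    ENNReal.ofReal_prod_of_nonneg fun j _ => (Real.exp_pos _).le]
  · refine Finset.prod_congr rfl fun j _ => ?_
    rw [hX.lintegral_comp_pointCount (hmeas _) (hvol _ (e.symm j).2)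
      (f := fun x => ENNReal.ofReal (Real.exp (-(((e.symm j : s) : ℝ≥0∞).toReal * x.toReal))))
      (by fun_prop)]
    simp only [ENNReal.toReal_natCast]
    rw [lintegral_exp_neg_poissonMeasure]
    congr 3
    have : 0 ≤ 1 - Real.exp (-((e.symm j : s) : ℝ≥0∞).toReal) := by simp
    simp only [ENNReal.coe_toNNReal_eq_toReal, ENNReal.toReal_mul, ENNReal.toReal_ofReal this]
    ring
  · exact fun j _ => ENNReal.mul_ne_top ENNReal.ofReal_ne_top
      (ENNReal.mul_ne_top ENNReal.ofReal_ne_top (hvol _ (e.symm j).2))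

/-- The Laplace functional of a Poisson point process, for functions of finite integral. -/
theorem IsPoissonPointProcess.lintegral_exp_neg_tsum [SigmaFinite (volume : Measure E)]
    [IsProbabilityMeasure P] (hX : IsPoissonPointProcess P X lam) {f : E → ℝ≥0∞}
    (hf : Measurable f) (hfin : ∫⁻ y, f y ≠ ∞) :
    ∫⁻ ω, ENNReal.ofReal (Real.exp (-(∑' n, f (X n ω)).toReal)) ∂P =
      ENNReal.ofReal (Real.exp (-(ENNReal.ofReal lam *
        ∫⁻ y, ENNReal.ofReal (1 - Real.exp (-(f y).toReal))).toReal)) := by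
  have hXm := hX.measurable
  set g := SimpleFunc.eapprox f with hg
  have hg_mono : ∀ x, Monotone fun k => g k x := fun x i j hij =>
    SimpleFunc.monotone_eapprox f hij x
  have hg_lim : ∀ x, Tendsto (fun k => g k x) atTop (𝓝 (f x)) := by
    intro x
    have h1 := tendsto_atTop_iSup (hg_mono x)
    rwa [SimpleFunc.iSup_eapprox_apply hf] at h1
  have hg_le : ∀ k x, g k x ≤ f x := fun k x => (hg_mono x).ge_of_tendsto (hg_lim x) k
  have hg_top : ∀ k x, g k x ≠ ∞ := fun k x => (SimpleFunc.eapprox_lt_top f k x).ne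
  have hf_top : ∀ᵐ y, f y ≠ ∞ := (ae_lt_top hf hfin).mono fun y hy => hy.ne
  have hsum_top : ∀ᵐ ω ∂P, ∑' n, f (X n ω) ≠ ∞ := by
    have h1 := hX.lintegral_tsum hf
    exact (ae_lt_top (Measurable.tsum fun n => hf.comp (hXm n)) (h1.trans_ne
      (ENNReal.mul_ne_top ENNReal.ofReal_ne_top hfin))).mono fun ω h => h.ne
  have hsum_lim : ∀ ω, Tendsto (fun k => ∑' n, g k (X n ω)) atTop (𝓝 (∑' n, f (X n ω))) := by
    intro ω
    simp_rw [← lintegral_count]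
    exact lintegral_tendsto_of_tendsto_of_monotone (fun k => .of_discrete)
      (ae_of_all _ fun n => hg_mono _) (ae_of_all _ fun n => hg_lim _)
  have hleft : Tendsto (fun k => ∫⁻ ω, ENNReal.ofReal (Real.exp (-(∑' n, g k (X n ω)).toReal)) ∂P)
      atTop (𝓝 (∫⁻ ω, ENNReal.ofReal (Real.exp (-(∑' n, f (X n ω)).toReal)) ∂P)) := by
    refine tendsto_lintegral_of_dominated_convergence (fun _ => 1) (fun k => ?_)
      (fun k => ae_of_all _ fun ω => ?_) (by simp) ?_
    · have : Measurable fun ω => ∑' n, g k (X n ω) :=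
        Measurable.tsum fun n => (g k).measurable.comp (hXm n)
      fun_prop
    · simp
    · filter_upwards [hsum_top] with ω hω
      exact ENNReal.tendsto_ofReal ((Real.continuous_exp.tendsto _).comp
        ((ENNReal.tendsto_toReal hω).comp (hsum_lim ω)).neg)
  have hφ_fin : ∫⁻ y, ENNReal.ofReal (1 - Real.exp (-(f y).toReal)) ≠ ∞ := by
    refine ne_top_of_le_ne_top hfin (lintegral_mono_ae ?_)
    filter_upwards [hf_top] with y hy
    rw [← ENNReal.ofReal_toReal hy]
    refine ENNReal.ofReal_le_ofReal ?_
    rw [ENNReal.ofReal_toReal hy]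
    linarith [Real.add_one_le_exp (-(f y).toReal)]
  have hright : Tendsto (fun k => ∫⁻ y, ENNReal.ofReal (1 - Real.exp (-(g k y).toReal))) atTop
      (𝓝 (∫⁻ y, ENNReal.ofReal (1 - Real.exp (-(f y).toReal)))) := by
    refine lintegral_tendsto_of_tendsto_of_monotone (fun k => ?_) ?_ ?_
    · have := (g k).measurable
      fun_prop
    · refine ae_of_all _ fun y i j hij => ENNReal.ofReal_le_ofReal ?_
      have := ENNReal.toReal_mono (hg_top j y) (hg_mono y hij)
      gcongr
    · filter_upwards [hf_top] with y hy
      exact ENNReal.tendsto_ofReal (((Real.continuous_exp.tendsto _).comp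
        ((ENNReal.tendsto_toReal hy).comp (hg_lim y)).neg).const_sub 1)
  refine tendsto_nhds_unique hleft ?_
  have h1 : ∀ k, ∫⁻ y, g k y ≠ ∞ := fun k =>
    ne_top_of_le_ne_top hfin (lintegral_mono fun y => hg_le k y)
  simp_rw [fun k => hX.lintegral_exp_neg_simpleFunc (g k) (hg_top k) (h1 k)]
  exact ENNReal.tendsto_ofReal ((Real.continuous_exp.tendsto _).comp
    ((ENNReal.tendsto_toReal (ENNReal.mul_ne_top ENNReal.ofReal_ne_top hφ_fin)).comp
      (ENNReal.Tendsto.const_mul hright (Or.inr ENNReal.ofReal_ne_top))).neg)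

end poisson

/-! ### Bounds on the exponent of the rate formula -/

section bounds

variable {ι : Type*} {l : ι → ℝ} {b : ι} {μ lam c t : ℝ}

lemma summable_log_loss (hs : Summable l) (s c : ℝ) :
    Summable fun i => Real.log (1 + s * (l i / c)) :=
  Real.summable_log_one_add_of_summable ((hs.div_const c).mul_left s)

lemma rateExponent_le (hl : ∀ i, 0 < l i) (hs : Summable l) (hμ : 0 < μ) (σ : ℝ)
    (hlam : 0 < lam) (ht : 0 ≤ t) (hc : 0 < c) (hcb : c ≤ l b) :
    rateExponent σ μ lam l b t ≤
      μ * σ ^ 2 * (t / lam) / c + ∑' i, Real.log (1 + t / lam * (l i / c)) := by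
  refine add_le_add (by gcongr) ?_
  refine (summable_log_loss hs _ _).tsum_le_tsum (fun i => ?_) (summable_log_loss hs _ _)
  have := hl i
  have := hl b
  refine Real.log_le_log (by positivity) ?_
  gcongr

lemma le_rateExponent (hl : ∀ i, 0 < l i) (hs : Summable l) (hμ : 0 < μ) (σ : ℝ)
    (hlam : 0 < lam) (ht : 0 ≤ t) (hcb : l b ≤ c) :
    ∑' i, Real.log (1 + t / lam * (l i / c)) ≤ rateExponent σ μ lam l b t := by
  unfold rateExponent
  have hb := hl b
  have hc := hb.trans_le hcb
  refine le_add_of_nonneg_of_le (by positivity) ?_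
  refine (summable_log_loss hs _ _).tsum_le_tsum (fun i => ?_) (summable_log_loss hs _ _)
  have := hl i
  refine Real.log_le_log (by positivity) ?_
  gcongr

end bounds

/-! ### Poisson networks -/

section nearest

variable {E : Type*} [NormedAddCommGroup E]

lemma measurable_nearestIndex [MeasurableSpace E] [OpensMeasurableSpace E] :
    Measurable fun x : ℕ → E => nearestIndex x 0 := by
  have hV : ∀ n, MeasurableSet {x : ℕ → E | (0 : E) ∈ voronoiCell x n} := by
    intro n
    have : {x : ℕ → E | (0 : E) ∈ voronoiCell x n} = ⋂ i, {x | ‖x n‖ ≤ ‖x i‖} := by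
      ext x; simp [voronoiCell]
    rw [this]
    exact MeasurableSet.iInter fun i => measurableSet_le (by fun_prop) (by fun_prop)
  -- If no nearest station exists, `nearestIndex` is `sInf ∅ = 0`.
  refine measurable_to_countable' fun n => ?_
  have : (fun x : ℕ → E => nearestIndex x 0) ⁻¹' {n} =
      ({x | (0 : E) ∈ voronoiCell x n} ∩ ⋂ m, ⋂ _ : m < n, {x | (0 : E) ∈ voronoiCell x m}ᶜ) ∪
        ({_x | n = 0} ∩ ⋂ m, {x | (0 : E) ∈ voronoiCell x m}ᶜ) := by
    ext x
    simp only [Set.mem_preimage, Set.mem_singleton_iff, Set.mem_union, Set.mem_inter_iff,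
      Set.mem_iInter, Set.mem_compl_iff, Set.mem_ofPred_eq, nearestIndex]
    constructor
    · rintro rfl
      by_cases hne : {b | (0 : E) ∈ voronoiCell x b}.Nonempty
      · exact Or.inl ⟨Nat.sInf_mem hne, fun m hm => Nat.notMem_of_lt_sInf hm⟩
      · rw [Set.not_nonempty_iff_eq_empty] at hne
        refine Or.inr ⟨by rw [hne, Nat.sInf_empty], fun m hm => ?_⟩
        have : m ∈ {b | (0 : E) ∈ voronoiCell x b} := hm
        rw [hne] at this
        exact this
    · rintro (⟨h1, h2⟩ | ⟨rfl, h2⟩)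
      · refine le_antisymm (Nat.sInf_le h1) (le_of_not_gt fun hlt => h2 _ hlt ?_)
        exact Nat.sInf_mem (s := {b | (0 : E) ∈ voronoiCell x b}) ⟨n, h1⟩
      · rw [Nat.sInf_eq_zero]
        exact Or.inr (Set.eq_empty_of_forall_notMem h2)
  rw [this]
  exact ((hV n).inter (MeasurableSet.iInter fun m => MeasurableSet.iInter fun _ =>
    (hV m).compl)).union ((MeasurableSet.const _).inter
    (MeasurableSet.iInter fun m => (hV m).compl))

/-- If the received powers are summable, the stations do not accumulate, so a nearest one exists. -/
lemma norm_nearestIndex_le {h α : ℝ} (hh : 0 < h) (hα : 0 ≤ α) {x : ℕ → E}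
    (hs : Summable fun n => pathLoss h α (dist (x n) 0)) (n : ℕ) :
    ‖x (nearestIndex x 0)‖ ≤ ‖x n‖ := by
  -- Stations at least as near as `x 0` are received at least as strongly, so there are only
  -- finitely many.
  have hfin : {n | ‖x n‖ ≤ ‖x 0‖}.Finite := by
    have h1 := hs.tendsto_cofinite_zero.eventually_lt_const (pathLoss_pos hh α ‖x 0‖)
    refine Set.Finite.subset (Filter.eventually_cofinite.1 h1) fun m hm => not_lt.2 ?_
    rw [dist_zero_right]
    exact pathLoss_le_pathLoss hh hα (norm_nonneg _) hm
  obtain ⟨b, hb, hmin⟩ := Set.exists_min_image _ (fun n => ‖x n‖) hfin ⟨0, by simp⟩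
  have hmem : b ∈ {b | (0 : E) ∈ voronoiCell x b} := by
    intro i
    simp only [dist_zero_right]
    rcases le_total ‖x i‖ ‖x 0‖ with h1 | h1
    · exact hmin i h1
    · exact hb.trans h1
  have := Nat.sInf_mem (s := {b | (0 : E) ∈ voronoiCell x b}) ⟨b, hmem⟩ n
  simpa [nearestIndex] using this

end nearest

section poisson

variable {E : Type*} [NormedAddCommGroup E] [NormedSpace ℝ E] [FiniteDimensional ℝ E]
  [MeasureSpace E] [BorelSpace E] [(volume : Measure E).IsAddHaarMeasure] {h α : ℝ}

lemma pathLoss_eq_mul_relLoss (hh : 0 < h) (r : ℝ) :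
    pathLoss h α r = pathLoss h α 0 * relLoss h α r := by
  rw [relLoss, mul_div_cancel₀ _ (pathLoss_pos hh α 0).ne']

lemma IsPoissonPointProcess.ae_summable_pathLoss (hh : 0 < h)
    (hα : (Module.finrank ℝ E : ℝ) < α) {Ω : Type*} [MeasurableSpace Ω] {P : Measure Ω}
    {X : ℕ → Ω → E} {lam : ℝ} (hX : IsPoissonPointProcess P X lam) :
    ∀ᵐ ω ∂P, Summable fun n => pathLoss h α (dist (X n ω) 0) := by
  have hm : Measurable fun y : E => ENNReal.ofReal (relLoss h α ‖y‖) :=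
    ((continuous_relLoss hh).measurable.comp measurable_norm).ennreal_ofReal
  have h1 := hX.lintegral_tsum hm
  have h2 : ∫⁻ y : E, ENNReal.ofReal (relLoss h α ‖y‖) ≠ ∞ :=
    (integrable_relLoss hh hα).lintegral_lt_top.ne
  filter_upwards [ae_lt_top (Measurable.tsum fun n => hm.comp (hX.measurable n)) (h1.trans_ne
    (ENNReal.mul_ne_top ENNReal.ofReal_ne_top h2))] with ω hω
  refine ((ENNReal.summable_toReal hω.ne).mul_left (pathLoss h α 0)).congr fun n => ?_
  simp only [Function.comp]
  rw [dist_zero_right, pathLoss_eq_mul_relLoss hh ‖X n ω‖,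
    ENNReal.toReal_ofReal (relLoss_pos hh _).le]

/-- Laplace functional of the received powers, averaged over the fading. -/
lemma IsPoissonPointProcess.lintegral_exp_neg_tsum_log (hh : 0 < h)
    (hα : (Module.finrank ℝ E : ℝ) < α) {Ω : Type*} [MeasurableSpace Ω] {P : Measure Ω}
    [IsProbabilityMeasure P] {X : ℕ → Ω → E} {lam : ℝ} (hlam : 0 < lam)
    (hX : IsPoissonPointProcess P X lam) {t c : ℝ} (ht : 0 ≤ t) (hc : 0 < c) :
    ∫⁻ ω, ENNReal.ofReal (Real.exp
        (-∑' n, Real.log (1 + t / lam * (pathLoss h α (dist (X n ω) 0) / c)))) ∂P =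
      ENNReal.ofReal (Real.exp (-lossExponent E h α 0 lam (t * (pathLoss h α 0 / c)))) := by
  set q := t * (pathLoss h α 0 / c) with hq
  have hq0 : 0 ≤ q := by have := pathLoss_pos hh α 0; positivity
  have hz0 : ∀ y : E, 0 ≤ q * relLoss h α ‖y‖ / lam := fun y => by
    have := relLoss_pos (α := α) hh ‖y‖
    positivity
  set f : E → ℝ≥0∞ := fun y => ENNReal.ofReal (Real.log (1 + q * relLoss h α ‖y‖ / lam)) with hf
  have hlog0 : ∀ y : E, 0 ≤ Real.log (1 + q * relLoss h α ‖y‖ / lam) := fun y =>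
    Real.log_nonneg (by linarith [hz0 y])
  have hkm : Measurable fun y : E => relLoss h α ‖y‖ :=
    (continuous_relLoss hh).measurable.comp measurable_norm
  have hfm : Measurable f := by fun_prop
  have hfin : ∫⁻ y, f y ≠ ∞ := by
    refine ne_top_of_le_ne_top
      (((integrable_relLoss (E := E) hh hα).const_mul (q / lam)).lintegral_lt_top.ne)
      (lintegral_mono fun y => ENNReal.ofReal_le_ofReal ?_)
    have := Real.log_le_sub_one_of_pos (x := 1 + q * relLoss h α ‖y‖ / lam) (by linarith [hz0 y])
    calc _ ≤ _ := this
      _ = _ := by ring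
  have e1 : ∀ ω, ∑' n, Real.log (1 + t / lam * (pathLoss h α (dist (X n ω) 0) / c)) =
      (∑' n, f (X n ω)).toReal := by
    intro ω
    rw [ENNReal.tsum_toReal_eq fun n => ENNReal.ofReal_ne_top]
    refine tsum_congr fun n => ?_
    rw [ENNReal.toReal_ofReal (hlog0 _), dist_zero_right,
      pathLoss_eq_mul_relLoss hh ‖X n ω‖, hq]
    congr 2
    ring
  simp_rw [e1]
  rw [hX.lintegral_exp_neg_tsum hfm hfin]
  congr 3
  have e2 : ∀ y : E, 1 - Real.exp (-(f y).toReal) =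
      lam⁻¹ * (q * relLoss h α (‖y‖ + 0) / (1 + q * relLoss h α (‖y‖ + 0) / lam)) := by
    intro y
    have h1 := hz0 y
    rw [hf, ENNReal.toReal_ofReal (hlog0 _), Real.exp_neg, Real.exp_log (by linarith), add_zero]
    have h2 : 1 + q * relLoss h α ‖y‖ / lam ≠ 0 := by linarith
    have h3 : lam + q * relLoss h α ‖y‖ ≠ 0 := by
      have := relLoss_pos (α := α) hh ‖y‖
      positivity
    field_simp
    ring
  simp_rw [e2]
  have hi := integrable_saturation (E := E) hh hα le_rfl hlam hq0
  rw [← ofReal_integral_eq_lintegral_ofReal (hi.const_mul _) (ae_of_all _ fun y => ?_),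
    integral_const_mul, ← ENNReal.ofReal_mul hlam.le, mul_inv_cancel_left₀ hlam.ne']
  · refine ENNReal.toReal_ofReal (integral_nonneg fun y => ?_)
    have := relLoss_pos (α := α) hh (‖y‖ + 0)
    change 0 ≤ q * relLoss h α (‖y‖ + 0) / (1 + q * relLoss h α (‖y‖ + 0) / lam)
    positivity
  · have := relLoss_pos (α := α) hh (‖y‖ + 0)
    change 0 ≤ lam⁻¹ * (q * relLoss h α (‖y‖ + 0) / (1 + q * relLoss h α (‖y‖ + 0) / lam))
    positivity

lemma lossExponent_le (hh : 0 < h) (hα : (Module.finrank ℝ E : ℝ) < α) {lam t : ℝ}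
    (hlam : 0 < lam) (ht : 0 ≤ t) : lossExponent E h α 0 lam t ≤ t * totalLoss E h α := by
  rw [totalLoss, ← integral_const_mul]
  refine integral_mono (integrable_saturation hh hα le_rfl hlam ht)
    ((integrable_relLoss hh hα).const_mul t) fun y => ?_
  have := relLoss_pos (α := α) hh (‖y‖ + 0)
  refine (saturation_le (by positivity) hlam).trans_eq ?_
  rw [add_zero]

/-- Poisson networks: the area spectral efficiency converges to `1 / (log 2 * totalLoss)`. -/
theorem IsPoissonNetwork.aseTendsto (hh : 0 < h) [Nontrivial E]
    (hα : (Module.finrank ℝ E : ℝ) < α) {μ : ℝ} (hμ : 0 < μ) (σ : ℝ) {Ω : ℝ → Type*}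
    [∀ lam, MeasurableSpace (Ω lam)] {P : ∀ lam, Measure (Ω lam)}
    [∀ lam, IsProbabilityMeasure (P lam)] {X : ∀ lam, ℕ → Ω lam → E} {G : ∀ lam, ℕ → Ω lam → ℝ}
    (hN : ∀ lam, 0 < lam → IsPoissonNetwork (P lam) (X lam) (G lam) lam μ) :
    ASETendsto P (fun lam => poissonSINR h α σ (X lam) (G lam))
      (1 / (totalLoss E h α * Real.log 2)) := by
  have hα0 : 0 < α := lt_of_le_of_lt (Nat.cast_nonneg _) hα
  have hd : 0 < Module.finrank ℝ E := Module.finrank_pos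
  set l : (ℕ → E) → ℕ → ℝ := fun x n => pathLoss h α (dist (x n) 0) with hl
  have hlm : ∀ n, Measurable fun x => l x n := fun n =>
    (continuous_pathLoss hh α).measurable.comp (by fun_prop)
  have hl0 : ∀ x n, 0 < l x n := fun x n => pathLoss_pos hh _ _
  have hWm : ∀ lam, 0 < lam → Measurable fun ω n => X lam n ω := fun lam hlam =>
    measurable_pi_iff.2 (hN lam hlam).points.measurable
  have hsum : ∀ lam, 0 < lam → ∀ᵐ ω ∂P lam, Summable (l fun n => X lam n ω) := fun lam hlam =>
    (hN lam hlam).points.ae_summable_pathLoss hh hα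
  have hb := measurable_nearestIndex (E := E)
  -- The nearest station is within distance `r`, up to an event of probability `ε`. The exponent in
  -- `r` is such that `r → 0` while the mean number of stations within `r` tends to infinity.
  set r : ℝ → ℝ := fun lam => lam ^ (-(1 / (2 * (Module.finrank ℝ E : ℝ)))) with hr
  have hr0 : ∀ lam, 0 < lam → 0 < r lam := fun lam hlam => Real.rpow_pos_of_pos hlam _
  have hr_lim : Tendsto r atTop (𝓝 0) := tendsto_rpow_neg_atTop (by positivity)
  set v := volume.real (Metric.ball (0 : E) 1) with hv
  have hv0 : 0 < v := ENNReal.toReal_pos (Metric.measure_ball_pos _ _ one_pos).ne'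
    measure_ball_lt_top.ne
  have hball : ∀ lam, 0 < lam →
      lam * volume.real (Metric.ball (0 : E) (r lam)) = lam ^ (1 / 2 : ℝ) * v := by
    intro lam hlam
    rw [measureReal_def, Measure.addHaar_ball _ _ (hr0 lam hlam).le, ENNReal.toReal_mul,
      ENNReal.toReal_ofReal (by have := hr0 lam hlam; positivity), hv, measureReal_def, ← mul_assoc,
      hr, ← Real.rpow_natCast, ← Real.rpow_mul hlam.le, ← Real.rpow_one_add' hlam.le]
    · congr 2
      field_simp
      norm_num
    · field_simp
      norm_num
  set ε : ℝ → ℝ := fun lam => Real.exp (-(lam ^ (1 / 2 : ℝ) * v)) with hε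
  have hε_lim : Tendsto ε atTop (𝓝 0) := by
    refine Real.tendsto_exp_neg_atTop_nhds_zero.comp ?_
    exact (tendsto_rpow_atTop (by norm_num)).atTop_mul_const hv0
  set M : ℝ → ℝ := fun lam => μ * σ ^ 2 / pathLoss h α (r lam) / lam +
    pathLoss h α 0 / pathLoss h α (r lam) * totalLoss E h α with hM
  have hM_lim : Tendsto M atTop (𝓝 (totalLoss E h α)) := by
    have hp := pathLoss_pos hh α 0
    have h1 : Tendsto (fun lam => pathLoss h α (r lam)) atTop (𝓝 (pathLoss h α 0)) :=
      ((continuous_pathLoss hh α).tendsto 0).comp hr_lim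
    have h2 := ((tendsto_const_nhds (x := μ * σ ^ 2)).div h1 hp.ne').div_atTop tendsto_id
    have h3 := ((tendsto_const_nhds (x := pathLoss h α 0)).div h1 hp.ne').mul_const
      (totalLoss E h α)
    simpa [div_self hp.ne'] using h2.add h3
  refine aseTendsto_of_bounds (E := E) hh hα (a := fun _ => 0) (M := M) (ε := ε)
    (A := fun lam t => ∫⁻ ω, ENNReal.ofReal (Real.exp (-rateExponent σ μ lam
      (l fun n => X lam n ω) (nearestIndex (fun n => X lam n ω) 0) t)) ∂P lam)
    ?_ ?_ ?_ ?_ (fun _ _ => le_rfl) antitoneOn_const tendsto_const_nhds ?_ ?_ hM_lim hε_lim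
  · intro lam hlam
    have hGm : Measurable fun ω n => G lam n ω :=
      measurable_pi_iff.2 (hN lam hlam).fading.measurable
    exact ((measurable_sinr_of_loss hlm hb σ).comp ((hWm lam hlam).prodMk hGm)).aemeasurable
  · intro lam hlam
    filter_upwards [(hN lam hlam).fading.ae_pos hμ] with ω hω
    refine div_nonneg (mul_nonneg (hω _).le (pathLoss_pos hh _ _).le) (add_nonneg ?_ (sq_nonneg σ))
    exact tsum_nonneg fun i => mul_nonneg (hω _).le (pathLoss_pos hh _ _).le
  · intro lam hlam
    exact (hN lam hlam).fading.lintegral_log_sinr_of_indepFun hμ (hWm lam hlam) (hN lam hlam).indep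
      hlm hl0 hb (hsum lam hlam) σ hlam
  · intro lam hlam
    refine Measurable.lintegral_prod_right' (f := fun p : ℝ × Ω lam => ENNReal.ofReal (Real.exp
      (-rateExponent σ μ lam (l fun n => X lam n p.2) (nearestIndex (fun n => X lam n p.2) 0)
        p.1))) ?_
    exact (Real.measurable_exp.comp (((measurable_rateExponent hlm hb σ μ lam).comp
      (((hWm lam hlam).comp measurable_snd).prodMk measurable_fst)).neg)).ennreal_ofReal
  · intro lam t hlam ht
    have h1 := (hN lam hlam).points.lintegral_exp_neg_tsum_log hh hα hlam ht.le
      (pathLoss_pos hh α 0)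
    rw [div_self (pathLoss_pos hh α 0).ne', mul_one] at h1
    rw [← h1]
    refine lintegral_mono_ae ?_
    filter_upwards [hsum lam hlam] with ω hω
    exact ENNReal.ofReal_le_ofReal (Real.exp_le_exp.2 (neg_le_neg (le_rateExponent (hl0 _) hω hμ σ
      hlam ht.le (pathLoss_le_pathLoss hh hα0.le le_rfl dist_nonneg))))
  · intro lam t hlam ht
    have hX := (hN lam hlam).points
    set c := pathLoss h α (r lam) with hc
    have hc0 : 0 < c := pathLoss_pos hh _ _
    have hp0 := pathLoss_pos hh α 0
    set N := {ω | pointCount (X lam) (Metric.ball 0 (r lam)) ω = 0}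
    have hNm : MeasurableSet N :=
      measurable_pointCount hX.measurable measurableSet_ball (measurableSet_singleton 0)
    have hNP : P lam N = ENNReal.ofReal (ε lam) := by
      rw [hX.measure_pointCount_eq_zero hlam.le measurableSet_ball measure_ball_lt_top.ne,
        hball lam hlam]
    rw [ENNReal.ofReal_sub _ (Real.exp_pos _).le, tsub_le_iff_right, ← hNP,
      ← lintegral_indicator_one hNm, ← lintegral_add_right _ (measurable_one.indicator hNm)]
    have h1 := hX.lintegral_exp_neg_tsum_log hh hα hlam ht.le hc0
    calc ENNReal.ofReal (Real.exp (-(t * M lam)))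
        ≤ ENNReal.ofReal (Real.exp (-(μ * σ ^ 2 * (t / lam) / c))) * ENNReal.ofReal
            (Real.exp (-lossExponent E h α 0 lam (t * (pathLoss h α 0 / c)))) := by
          rw [← ENNReal.ofReal_mul (Real.exp_pos _).le, ← Real.exp_add]
          refine ENNReal.ofReal_le_ofReal (Real.exp_le_exp.2 ?_)
          have h2 := lossExponent_le (E := E) hh hα hlam
            (t := t * (pathLoss h α 0 / c)) (by positivity)
          have h3 : t * M lam = μ * σ ^ 2 * (t / lam) / c +
            t * (pathLoss h α 0 / c) * totalLoss E h α := by rw [hM]; ring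
          linarith
      _ ≤ _ := by
          rw [← h1, ← lintegral_const_mul' _ _ ENNReal.ofReal_ne_top]
          refine lintegral_mono_ae ?_
          filter_upwards [hsum lam hlam] with ω hω
          rw [← ENNReal.ofReal_mul (Real.exp_pos _).le, ← Real.exp_add, ← neg_add]
          have hexp0 : 0 ≤ μ * σ ^ 2 * (t / lam) / c +
              ∑' n, Real.log (1 + t / lam * (pathLoss h α (dist (X lam n ω) 0) / c)) := by
            refine add_nonneg (by positivity) (tsum_nonneg fun n => Real.log_nonneg ?_)
            have := pathLoss_pos hh α (dist (X lam n ω) 0)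
            have : 0 ≤ t / lam * (pathLoss h α (dist (X lam n ω) 0) / c) := by positivity
            linarith
          by_cases hωN : ω ∈ N
          · rw [Set.indicator_of_mem hωN]
            refine le_add_left ?_
            change ENNReal.ofReal _ ≤ 1
            rw [ENNReal.ofReal_le_one, Real.exp_le_one_iff, neg_nonpos]
            exact hexp0
          · refine le_add_right (ENNReal.ofReal_le_ofReal (Real.exp_le_exp.2 (neg_le_neg ?_)))
            refine rateExponent_le (hl0 _) hω hμ σ hlam ht.le hc0 ?_
            obtain ⟨n, hn⟩ : ∃ n, ‖X lam n ω‖ < r lam := by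
              by_contra! hcon
              refine hωN (ENNReal.tsum_eq_zero.2 fun n => Set.indicator_of_notMem ?_ _)
              simpa using hcon n
            refine pathLoss_le_pathLoss hh hα0.le dist_nonneg ?_
            rw [dist_zero_right]
            exact (norm_nearestIndex_le hh hα0.le hω n).trans hn.le

end poisson

/-! ### Regular networks -/

/-- The sets `V i` tile the space; `V i` has volume `1 / lam` and lies within distance `ρ` of the
station `x i`. The sets need not be the Voronoi cells. -/
structure IsTiling {ι E : Type*} [MetricSpace E] [MeasureSpace E] (x : ι → E) (V : ι → Set E)
    (lam ρ : ℝ) : Prop where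
  measurableSet : ∀ i, MeasurableSet (V i)
  disjoint : Pairwise (Function.onFun Disjoint V)
  iUnion : ⋃ i, V i = Set.univ
  volume_real : ∀ i, volume.real (V i) = 1 / lam
  dist_le : ∀ i, ∀ y ∈ V i, dist (x i) y ≤ ρ

section tiling

variable {ι E : Type*}

section

variable [MetricSpace E] [MeasureSpace E] {x : ι → E} {V : ι → Set E} {lam ρ : ℝ}

lemma IsTiling.hasSum_integral [Countable ι] (hV : IsTiling x V lam ρ) {f : E → ℝ}
    (hf : Integrable f) : HasSum (fun i => ∫ y in V i, f y) (∫ y, f y) := by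
  have := hasSum_integral_iUnion hV.measurableSet hV.disjoint (f := f) (μ := volume)
    hf.integrableOn
  rwa [hV.iUnion, Measure.restrict_univ] at this

lemma IsTiling.volume_ne_top (hV : IsTiling x V lam ρ) (hlam : 0 < lam) (i : ι) :
    volume (V i) ≠ ∞ := by
  intro htop
  have := hV.volume_real i
  rw [measureReal_def, htop, ENNReal.toReal_top] at this
  exact (one_div_pos.2 hlam).ne this

lemma IsTiling.integral_le_tsum [Countable ι] (hV : IsTiling x V lam ρ) (hlam : 0 < lam) {f : E → ℝ}
    (hf : Integrable f) {c : ι → ℝ} (hc : Summable c) (hfc : ∀ i, ∀ y ∈ V i, f y ≤ lam * c i) :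
    ∫ y, f y ≤ ∑' i, c i := by
  refine hasSum_le (fun i => ?_) (hV.hasSum_integral hf) hc.hasSum
  have h1 := setIntegral_mono_on hf.integrableOn (integrableOn_const (hV.volume_ne_top hlam i))
    (hV.measurableSet i) (hfc i)
  rwa [setIntegral_const, hV.volume_real, smul_eq_mul, ← mul_assoc, one_div_mul_cancel hlam.ne',
    one_mul] at h1

lemma IsTiling.summable_and_tsum_le_integral [Countable ι] (hV : IsTiling x V lam ρ)
    (hlam : 0 < lam) {f : E → ℝ} (hf : Integrable f) {c : ι → ℝ} (hc0 : ∀ i, 0 ≤ c i)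
    (hfc : ∀ i, ∀ y ∈ V i, lam * c i ≤ f y) : Summable c ∧ ∑' i, c i ≤ ∫ y, f y := by
  have h1 : ∀ i, c i ≤ ∫ y in V i, f y := by
    intro i
    have h1 := setIntegral_mono_on (integrableOn_const (hV.volume_ne_top hlam i)) hf.integrableOn
      (hV.measurableSet i) (hfc i)
    rwa [setIntegral_const, hV.volume_real, smul_eq_mul, ← mul_assoc, one_div_mul_cancel hlam.ne',
      one_mul] at h1
  have h2 := hV.hasSum_integral hf
  have h3 := Summable.of_nonneg_of_le hc0 h1 h2.summable
  exact ⟨h3, hasSum_le h1 h3.hasSum h2⟩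

lemma IsTiling.dist_le_of_mem_voronoiCell (hV : IsTiling x V lam ρ) {b : ι} {u : E}
    (hu : u ∈ voronoiCell x b) : dist (x b) u ≤ ρ := by
  obtain ⟨i, hi⟩ := Set.mem_iUnion.1 (hV.iUnion.symm ▸ Set.mem_univ u)
  exact (hu i).trans (hV.dist_le i u hi)

lemma IsRegularNetwork.ae_mem_voronoiCell [Countable ι] [OpensMeasurableSpace E] {Ω : Type*}
    [MeasurableSpace Ω] {P : Measure Ω} {b : ι} {U : Ω → E} {G : ι → Ω → ℝ} {μ : ℝ}
    (hN : IsRegularNetwork P x b U G μ) : ∀ᵐ ω ∂P, U ω ∈ voronoiCell x b := by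
  have hm : MeasurableSet (voronoiCell x b) := by
    have : voronoiCell x b = ⋂ i, {u | dist (x b) u ≤ dist (x i) u} := by
      ext u; simp [voronoiCell]
    rw [this]
    exact (isClosed_iInter fun i => isClosed_le (by fun_prop) (by fun_prop)).measurableSet
  have h1 := hN.uniform_user
  rw [pdf.IsUniform] at h1
  have h2 : P.map U (voronoiCell x b)ᶜ = 0 := by rw [h1, cond_apply hm]; simp
  rwa [Measure.map_apply hN.measurable_user hm.compl] at h2

end

variable [NormedAddCommGroup E] [NormedSpace ℝ E] [FiniteDimensional ℝ E]
  [MeasureSpace E] [BorelSpace E] [(volume : Measure E).IsAddHaarMeasure] {h α : ℝ}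
  {x : ι → E} {V : ι → Set E} {lam ρ : ℝ}

/-- Total relative path loss when distances are decreased by `a`. -/
noncomputable def shrunkLoss (E : Type*) [NormedAddCommGroup E] [MeasureSpace E] (h α a : ℝ) : ℝ :=
  ∫ y : E, relLoss h α (max (‖y‖ - a) 0)

lemma integrable_shrunkLoss (hh : 0 < h) (hα : (Module.finrank ℝ E : ℝ) < α) {a : ℝ} :
    Integrable fun y : E => relLoss h α (max (‖y‖ - a) 0) :=
  integrable_relLoss_of_le hh hα (a := a) (by fun_prop)
    fun y => by linarith [le_max_left (‖y‖ - a) 0]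

lemma tendsto_shrunkLoss (hh : 0 < h) (hα : (Module.finrank ℝ E : ℝ) < α) {a : ℝ → ℝ}
    (ha0 : Tendsto a atTop (𝓝 0)) :
    Tendsto (fun lam => shrunkLoss E h α (a lam)) atTop (𝓝 (totalLoss E h α)) := by
  have hα0 : 0 < α := lt_of_le_of_lt (Nat.cast_nonneg _) hα
  refine tendsto_integral_filter_of_dominated_convergence
    (fun y => relLoss h α (max (‖y‖ - 1) 0))
    (Eventually.of_forall fun lam => (integrable_shrunkLoss hh hα).aestronglyMeasurable) ?_
    (integrable_shrunkLoss hh hα) (ae_of_all _ fun y => ?_)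
  · filter_upwards [ha0.eventually_lt_const one_pos] with lam h1
    refine ae_of_all _ fun y => ?_
    rw [Real.norm_of_nonneg (relLoss_pos hh _).le]
    exact relLoss_le_relLoss hh hα0.le (le_max_right _ _)
      (max_le_max_right _ (by linarith))
  · have h1 : Tendsto (fun lam => max (‖y‖ - a lam) 0) atTop (𝓝 (max (‖y‖ - 0) 0)) :=
      (ha0.const_sub _).max tendsto_const_nhds
    rw [sub_zero, max_eq_left (norm_nonneg y)] at h1
    exact ((continuous_relLoss hh).tendsto _).comp h1

lemma IsTiling.summable_relLoss [Countable ι] (hh : 0 < h) (hα : (Module.finrank ℝ E : ℝ) < α)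
    (hV : IsTiling x V lam ρ) (hlam : 0 < lam) {u : E} (hu : ‖u‖ ≤ ρ) :
    (Summable fun i => relLoss h α (dist (x i) u) / lam) ∧
      ∑' i, relLoss h α (dist (x i) u) / lam ≤ shrunkLoss E h α (2 * ρ) := by
  have hα0 : 0 < α := lt_of_le_of_lt (Nat.cast_nonneg _) hα
  refine hV.summable_and_tsum_le_integral hlam (integrable_shrunkLoss hh hα)
    (fun i => (div_pos (relLoss_pos hh _) hlam).le) fun i y hy => ?_
  rw [mul_div_cancel₀ _ hlam.ne']
  refine relLoss_le_relLoss hh hα0.le (le_max_right _ _) (max_le ?_ dist_nonneg)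
  have h1 := dist_triangle4 y (x i) u 0
  rw [dist_zero_right, dist_zero_right, dist_comm y] at h1
  linarith [hV.dist_le i y hy]

lemma IsTiling.lossExponent_le_tsum_log [Countable ι] (hh : 0 < h)
    (hα : (Module.finrank ℝ E : ℝ) < α)
    (hV : IsTiling x V lam ρ) (hlam : 0 < lam) {u : E} (hu : ‖u‖ ≤ ρ) {t : ℝ} (ht : 0 ≤ t) :
    lossExponent E h α (2 * ρ) lam t ≤
      ∑' i, Real.log (1 + t / lam * relLoss h α (dist (x i) u)) := by
  have hα0 : 0 < α := lt_of_le_of_lt (Nat.cast_nonneg _) hα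
  have hρ : 0 ≤ ρ := (norm_nonneg u).trans hu
  have hs : Summable fun i => Real.log (1 + t / lam * relLoss h α (dist (x i) u)) := by
    refine Real.summable_log_one_add_of_summable
      (((hV.summable_relLoss hh hα hlam hu).1.mul_left t).congr fun i => ?_)
    ring
  refine hV.integral_le_tsum hlam (integrable_saturation hh hα (by positivity) hlam ht) hs
    fun i y hy => ?_
  have hk := relLoss_pos (α := α) hh (dist (x i) u)
  set z := t * relLoss h α (dist (x i) u) with hz
  have hz0 : 0 ≤ z := by positivity
  have hz1 : 0 < 1 + z / lam := by positivity
  calc t * relLoss h α (‖y‖ + 2 * ρ) / (1 + t * relLoss h α (‖y‖ + 2 * ρ) / lam)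
      ≤ z / (1 + z / lam) := by
        have := relLoss_pos (α := α) hh (‖y‖ + 2 * ρ)
        refine saturation_mono (by positivity) ?_ hlam le_rfl
        refine mul_le_mul_of_nonneg_left (relLoss_le_relLoss hh hα0.le dist_nonneg ?_) ht
        have h1 := dist_triangle4 (x i) y 0 u
        rw [dist_zero_right, dist_zero_left] at h1
        linarith [hV.dist_le i y hy]
    _ = lam * (1 - (1 + z / lam)⁻¹) := by field_simp; ring
    _ ≤ lam * Real.log (1 + t / lam * relLoss h α (dist (x i) u)) := by
        have h1 := Real.one_sub_inv_le_log_of_pos hz1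
        rw [show t / lam * relLoss h α (dist (x i) u) = z / lam by rw [hz]; ring]
        gcongr

/-- Regular networks whose stations have tiles of vanishing diameter: the area spectral efficiency
converges to `1 / (log 2 * totalLoss)`. -/
theorem IsRegularNetwork.aseTendsto [Countable ι] (hh : 0 < h) [Nontrivial E] [Nontrivial ι]
    [MeasurableSpace ι] [MeasurableSingletonClass ι] (hα : (Module.finrank ℝ E : ℝ) < α)
    {μ : ℝ} (hμ : 0 < μ) (σ : ℝ)
    {x : ℝ → ι → E} {V : ℝ → ι → Set E} {ρ : ℝ → ℝ} {b : ι}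
    (hV : ∀ lam, 0 < lam → IsTiling (x lam) (V lam) lam (ρ lam)) (hxb : ∀ lam, x lam b = 0)
    (hρ0 : ∀ lam, 0 < lam → 0 ≤ ρ lam) (hρ : AntitoneOn ρ (Set.Ioi 0))
    (hρ_lim : Tendsto ρ atTop (𝓝 0)) {Ω : ℝ → Type*}
    [∀ lam, MeasurableSpace (Ω lam)] {P : ∀ lam, Measure (Ω lam)}
    [∀ lam, IsProbabilityMeasure (P lam)] {U : ∀ lam, Ω lam → E} {G : ∀ lam, ι → Ω lam → ℝ}
    (hN : ∀ lam, 0 < lam → IsRegularNetwork (P lam) (x lam) b (U lam) (G lam) μ) :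
    ASETendsto P (fun lam => regularSINR h α σ (x lam) b (U lam) (G lam))
      (1 / (totalLoss E h α * Real.log 2)) := by
  have hα0 : 0 < α := lt_of_le_of_lt (Nat.cast_nonneg _) hα
  have hp0 := pathLoss_pos hh α 0
  set l : ℝ → E → ι → ℝ := fun lam u i => pathLoss h α (dist (x lam i) u) with hl
  have hlm : ∀ lam i, Measurable fun u => l lam u i := fun lam i =>
    (continuous_pathLoss hh α).measurable.comp (by fun_prop)
  have hl0 : ∀ lam u i, 0 < l lam u i := fun lam u i => pathLoss_pos hh _ _
  have hlk : ∀ lam u i, l lam u i = pathLoss h α 0 * relLoss h α (dist (x lam i) u) :=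
    fun lam u i => pathLoss_eq_mul_relLoss hh _
  have hU : ∀ lam, 0 < lam → ∀ᵐ ω ∂P lam, ‖U lam ω‖ ≤ ρ lam := by
    intro lam hlam
    filter_upwards [(hN lam hlam).ae_mem_voronoiCell] with ω hω
    have := (hV lam hlam).dist_le_of_mem_voronoiCell hω
    rwa [hxb, dist_zero_left] at this
  have hsum : ∀ lam u, 0 < lam → ‖u‖ ≤ ρ lam → Summable (l lam u) := by
    intro lam u hlam hu
    refine (((hV lam hlam).summable_relLoss hh hα hlam hu).1.mul_left
      (pathLoss h α 0 * lam)).congr fun i => ?_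
    rw [hlk]
    field_simp
  have hb : Measurable fun _ : E => b := measurable_const
  set M : ℝ → ℝ := fun lam => μ * σ ^ 2 / pathLoss h α (ρ lam) / lam +
    pathLoss h α 0 / pathLoss h α (ρ lam) * shrunkLoss E h α (2 * ρ lam) with hM
  have hM_lim : Tendsto M atTop (𝓝 (totalLoss E h α)) := by
    have h1 : Tendsto (fun lam => pathLoss h α (ρ lam)) atTop (𝓝 (pathLoss h α 0)) :=
      ((continuous_pathLoss hh α).tendsto 0).comp hρ_lim
    have h2 := ((tendsto_const_nhds (x := μ * σ ^ 2)).div h1 hp0.ne').div_atTop tendsto_id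
    have h3 := ((tendsto_const_nhds (x := pathLoss h α 0)).div h1 hp0.ne').mul
      (tendsto_shrunkLoss (E := E) hh hα (a := fun lam => 2 * ρ lam)
        (by simpa using hρ_lim.const_mul 2))
    simpa [div_self hp0.ne'] using h2.add h3
  refine aseTendsto_of_bounds (E := E) hh hα (a := fun lam => 2 * ρ lam) (M := M) (ε := fun _ => 0)
    (A := fun lam t => ∫⁻ ω, ENNReal.ofReal (Real.exp (-rateExponent σ μ lam
      (l lam (U lam ω)) b t)) ∂P lam)
    ?_ ?_ ?_ ?_ (fun lam hlam => by have := hρ0 lam hlam; positivity)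
    (fun a ha c hc hac => mul_le_mul_of_nonneg_left (hρ ha hc hac) zero_le_two)
    (by simpa using hρ_lim.const_mul 2) ?_ ?_ hM_lim tendsto_const_nhds
  · intro lam hlam
    have hGm : Measurable fun ω n => G lam n ω :=
      measurable_pi_iff.2 (hN lam hlam).fading.measurable
    exact ((measurable_sinr_of_loss (hlm lam) hb σ).comp
      ((hN lam hlam).measurable_user.prodMk hGm)).aemeasurable
  · intro lam hlam
    filter_upwards [(hN lam hlam).fading.ae_pos hμ] with ω hω
    refine div_nonneg (mul_nonneg (hω _).le (pathLoss_pos hh _ _).le) (add_nonneg ?_ (sq_nonneg σ))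
    exact tsum_nonneg fun i => mul_nonneg (hω _).le (pathLoss_pos hh _ _).le
  · intro lam hlam
    exact (hN lam hlam).fading.lintegral_log_sinr_of_indepFun hμ (hN lam hlam).measurable_user
      (hN lam hlam).indep (hlm lam) (hl0 lam) hb
      ((hU lam hlam).mono fun ω hω => hsum lam _ hlam hω) σ hlam
  · intro lam hlam
    refine Measurable.lintegral_prod_right' (f := fun p : ℝ × Ω lam => ENNReal.ofReal (Real.exp
      (-rateExponent σ μ lam (l lam (U lam p.2)) b p.1))) ?_
    exact (Real.measurable_exp.comp (((measurable_rateExponent (hlm lam) hb σ μ lam).comp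
      (((hN lam hlam).measurable_user.comp measurable_snd).prodMk
        measurable_fst)).neg)).ennreal_ofReal
  · intro lam t hlam ht
    rw [← mul_one (ENNReal.ofReal (Real.exp (-lossExponent E h α (2 * ρ lam) lam t))),
      ← measure_univ (μ := P lam), ← lintegral_const]
    refine lintegral_mono_ae ?_
    filter_upwards [hU lam hlam] with ω hω
    refine ENNReal.ofReal_le_ofReal (Real.exp_le_exp.2 (neg_le_neg ?_))
    refine ((hV lam hlam).lossExponent_le_tsum_log hh hα hlam hω ht.le).trans ?_
    exact le_rateExponent (hl0 lam _) (hsum lam _ hlam hω) hμ σ hlam ht.le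
      (pathLoss_le_pathLoss hh hα0.le le_rfl dist_nonneg)
  · intro lam t hlam ht
    rw [sub_zero, ← mul_one (ENNReal.ofReal (Real.exp (-(t * M lam)))),
      ← measure_univ (μ := P lam), ← lintegral_const]
    refine lintegral_mono_ae ?_
    filter_upwards [hU lam hlam] with ω hω
    refine ENNReal.ofReal_le_ofReal (Real.exp_le_exp.2 (neg_le_neg ?_))
    set c := pathLoss h α (ρ lam) with hc
    have hc0 : 0 < c := pathLoss_pos hh _ _
    obtain ⟨hs, hle⟩ := (hV lam hlam).summable_relLoss hh hα hlam hω
    refine (rateExponent_le (hl0 lam _) (hsum lam _ hlam hω) hμ σ hlam ht.le hc0 ?_).trans ?_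
    · refine pathLoss_le_pathLoss hh hα0.le dist_nonneg ?_
      rwa [hxb, dist_zero_left]
    · have h1 : ∑' i, Real.log (1 + t / lam * (l lam (U lam ω) i / c)) ≤
          ∑' i, t * (pathLoss h α 0 / c) * (relLoss h α (dist (x lam i) (U lam ω)) / lam) := by
        refine (summable_log_loss (hsum lam _ hlam hω) _ _).tsum_le_tsum (fun i => ?_)
          (hs.mul_left _)
        have h2 := hl0 lam (U lam ω) i
        have h3 := Real.log_le_sub_one_of_pos
          (x := 1 + t / lam * (l lam (U lam ω) i / c)) (by positivity)
        refine h3.trans_eq ?_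
        rw [hlk]
        ring
      rw [tsum_mul_left] at h1
      have h2 := mul_le_mul_of_nonneg_left hle (a := t * (pathLoss h α 0 / c)) (by positivity)
      have h3 : t * M lam = μ * σ ^ 2 * (t / lam) / c +
          t * (pathLoss h α 0 / c) * shrunkLoss E h α (2 * ρ lam) := by rw [hM]; ring
      linarith

end tiling

/-! ### The two lattices -/

lemma lineLattice_isTiling {lam : ℝ} (hlam : 0 < lam) :
    IsTiling (lineLattice lam) (fun i => {y : ℝ | ⌊lam * y⌋ = i}) lam (1 / lam) := by
  have hV : ∀ i : ℤ, {y : ℝ | ⌊lam * y⌋ = i} = Set.Ico (i / lam) ((i + 1) / lam) := by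
    intro i
    ext y
    simp only [Set.mem_ofPred_eq, Int.floor_eq_iff, Set.mem_Ico, div_le_iff₀ hlam, lt_div_iff₀ hlam,
      mul_comm y]
  refine ⟨fun i => ?_, fun i j hij => ?_, ?_, fun i => ?_, fun i y hy => ?_⟩
  · rw [hV]; exact measurableSet_Ico
  · exact Set.disjoint_left.2 fun y (hi : _ = i) (hj : _ = j) => hij (hi.symm.trans hj)
  · exact Set.eq_univ_of_forall fun y => Set.mem_iUnion.2 ⟨_, rfl⟩
  · rw [hV, Real.volume_real_Ico_of_le (by gcongr; linarith)]
    ring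
  · rw [hV] at hy
    have h1 : ((i : ℝ) + 1) / lam = i / lam + 1 / lam := by ring
    have h2 : lineLattice lam i = i / lam := by rw [lineLattice]; ring
    rw [h1] at hy
    rw [Real.dist_eq, h2, abs_sub_le_iff]
    have := one_div_pos.2 hlam
    constructor <;> linarith [hy.1, hy.2]

lemma hexDistance_pos {lam : ℝ} (hlam : 0 < lam) : 0 < hexDistance lam := by
  unfold hexDistance; positivity

/-- Lattice coordinates of a point of the plane. -/
noncomputable def hexCoord (lam : ℝ) (y : EuclideanSpace ℝ (Fin 2)) : Fin 2 → ℝ :=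
  Matrix.toLin' !![1 / hexDistance lam, -(1 / (hexDistance lam * √3));
    0, 2 / (hexDistance lam * √3)] y

lemma hexCoord_zero (lam : ℝ) (y : EuclideanSpace ℝ (Fin 2)) :
    hexCoord lam y 0 = 1 / hexDistance lam * y 0 - 1 / (hexDistance lam * √3) * y 1 := by
  simp [hexCoord, Matrix.toLin'_apply, Matrix.mulVec, dotProduct, Fin.sum_univ_two]
  ring

lemma hexCoord_one (lam : ℝ) (y : EuclideanSpace ℝ (Fin 2)) :
    hexCoord lam y 1 = 2 / (hexDistance lam * √3) * y 1 := by
  simp [hexCoord, Matrix.toLin'_apply, Matrix.mulVec, dotProduct, Fin.sum_univ_two]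

/-- The parallelogram spanned by the lattice basis at the lattice point `p`. -/
noncomputable def hexTile (lam : ℝ) (p : ℤ × ℤ) : Set (EuclideanSpace ℝ (Fin 2)) :=
  {y | ⌊hexCoord lam y 0⌋ = p.1 ∧ ⌊hexCoord lam y 1⌋ = p.2}

lemma measurable_hexCoord (lam : ℝ) : Measurable (hexCoord lam) := by
  refine measurable_pi_iff.2 (Fin.forall_fin_two.2 ⟨?_, ?_⟩)
  · simp_rw [hexCoord_zero]; fun_prop
  · simp_rw [hexCoord_one]; fun_prop

lemma hexTile_volume {lam : ℝ} (hlam : 0 < lam) (p : ℤ × ℤ) :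
    volume.real (hexTile lam p) = 1 / lam := by
  have hΥ := hexDistance_pos hlam
  set Q := !![1 / hexDistance lam, -(1 / (hexDistance lam * √3));
    0, 2 / (hexDistance lam * √3)] with hQ
  have hdet : Q.det = lam := by
    have h3 : √3 * √3 = 3 := Real.mul_self_sqrt (by norm_num)
    have hΥ2 : hexDistance lam * hexDistance lam = 2 / (lam * √3) :=
      Real.mul_self_sqrt (by positivity)
    rw [hQ, Matrix.det_fin_two_of, mul_zero, sub_zero, div_mul_div_comm, one_mul, ← mul_assoc, hΥ2]
    field_simp
  have hset : hexTile lam p = (MeasurableEquiv.toLp 2 (Fin 2 → ℝ)).symm ⁻¹'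
      (Matrix.toLin' Q ⁻¹' (Set.univ.pi fun i => Set.Ico (if i = 0 then (p.1 : ℝ) else p.2)
        (if i = 0 then (p.1 : ℝ) + 1 else p.2 + 1))) := by
    ext y
    have h1 : Matrix.toLin' Q ((MeasurableEquiv.toLp 2 (Fin 2 → ℝ)).symm y) = hexCoord lam y := rfl
    simp only [hexTile, Set.mem_preimage, h1, Set.mem_univ_pi, Fin.forall_fin_two,
      Set.mem_ofPred_eq, Int.floor_eq_iff]
    simp
  have hBm : MeasurableSet (Set.univ.pi fun i : Fin 2 =>
      Set.Ico (if i = 0 then (p.1 : ℝ) else p.2) (if i = 0 then (p.1 : ℝ) + 1 else p.2 + 1)) :=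
    MeasurableSet.univ_pi fun i => measurableSet_Ico
  have hQm : Measurable (Matrix.toLin' Q) :=
    (LinearMap.continuous_of_finiteDimensional (Matrix.toLin' Q)).measurable
  rw [hset, measureReal_def, (EuclideanSpace.volume_preserving_symm_measurableEquiv_toLp
    (Fin 2)).measure_preimage (hQm hBm).nullMeasurableSet, Measure.addHaar_preimage_linearMap _
    (by rw [LinearMap.det_toLin', hdet]; exact hlam.ne'), LinearMap.det_toLin', hdet,
    volume_pi_pi]
  simp [Fin.prod_univ_two, abs_of_pos hlam, hlam.le]

lemma hexLattice_isTiling {lam : ℝ} (hlam : 0 < lam) :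
    IsTiling (hexLattice lam) (hexTile lam) lam (2 * hexDistance lam) := by
  have hΥ := hexDistance_pos hlam
  have hm := measurable_hexCoord lam
  refine ⟨fun p => ?_, fun p q hpq => ?_, ?_, fun p => hexTile_volume hlam p, fun p y hy => ?_⟩
  · have h1 : ∀ i, Measurable fun y => ⌊hexCoord lam y i⌋ := fun i =>
      Int.measurable_floor.comp ((measurable_pi_apply i).comp hm)
    exact ((h1 0) (measurableSet_singleton p.1)).inter ((h1 1) (measurableSet_singleton p.2))
  · refine Set.disjoint_left.2 fun y hp hq => hpq ?_
    exact Prod.ext (hp.1.symm.trans hq.1) (hp.2.symm.trans hq.2)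
  · exact Set.eq_univ_of_forall fun y => Set.mem_iUnion.2
      ⟨(⌊hexCoord lam y 0⌋, ⌊hexCoord lam y 1⌋), rfl, rfl⟩
  · obtain ⟨h1, h2⟩ := hy
    rw [Int.floor_eq_iff] at h1 h2
    set s := hexCoord lam y 0 - p.1 with hs
    set r := hexCoord lam y 1 - p.2 with hr
    have h3 : √3 * √3 = 3 := Real.mul_self_sqrt (by norm_num)
    have e0 : hexLattice lam p 0 - y 0 = -(hexDistance lam * (s + r / 2)) := by
      rw [hs, hr, hexCoord_zero, hexCoord_one]
      simp only [hexLattice, PiLp.toLp_apply, Matrix.cons_val_zero]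
      field_simp
      ring
    have e1 : hexLattice lam p 1 - y 1 = -(hexDistance lam * (r * √3 / 2)) := by
      rw [hr, hexCoord_one]
      simp only [hexLattice, PiLp.toLp_apply, Matrix.cons_val_one, Matrix.cons_val_fin_one]
      field_simp
      ring
    rw [EuclideanSpace.dist_eq, Fin.sum_univ_two, Real.dist_eq, Real.dist_eq, sq_abs, sq_abs,
      e0, e1]
    refine Real.sqrt_le_iff.2 ⟨by positivity, ?_⟩
    have hs0 : 0 ≤ s := by linarith [h1.1]
    have hs1 : s ≤ 1 := by linarith [h1.2]
    have hr0 : 0 ≤ r := by linarith [h2.1]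
    have hr1 : r ≤ 1 := by linarith [h2.2]
    have e2 : (-(hexDistance lam * (s + r / 2))) ^ 2 + (-(hexDistance lam * (r * √3 / 2))) ^ 2 =
        hexDistance lam ^ 2 * (s ^ 2 + s * r + r ^ 2) := by
      linear_combination (hexDistance lam ^ 2 * r ^ 2 / 4) * h3
    rw [e2, mul_pow, mul_comm]
    gcongr
    nlinarith [mul_le_mul hs1 hr1 hr0 zero_le_one]

lemma antitoneOn_hexDistance : AntitoneOn hexDistance (Set.Ioi 0) := by
  intro a ha c _ hac
  have ha : 0 < a := ha
  unfold hexDistance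
  gcongr

lemma tendsto_hexDistance : Tendsto hexDistance atTop (𝓝 0) := by
  have h1 : Tendsto (fun lam : ℝ => 2 / (lam * √3)) atTop (𝓝 0) :=
    (tendsto_id.atTop_mul_const (by positivity : (0 : ℝ) < √3)).const_div_atTop 2
  have h2 := (Real.continuous_sqrt.tendsto 0).comp h1
  rwa [Real.sqrt_zero] at h2

/-! ### The limit of the area spectral efficiency -/

theorem mainTheorem1 (h α : ℝ) (hh : 0 < h) :
    -- one-dimensional networks
    (1 < α → ∃ L : ℝ, L ≠ 0 ∧
      1 / (2 * Real.log 2 * h * (1 + Real.Gamma (α - 1) / Real.Gamma α)) ≤ L ∧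
      ∀ (μ σ : ℝ), 0 < μ →
      ∀ (Ω : ℝ → Type*) [∀ lam, MeasurableSpace (Ω lam)]
        (P : ∀ lam, Measure (Ω lam)) [∀ lam, IsProbabilityMeasure (P lam)],
        (∀ (U : ∀ lam, Ω lam → ℝ) (G : ∀ lam, ℤ → Ω lam → ℝ),
          (∀ lam, 0 < lam →
            IsRegularNetwork (P lam) (lineLattice lam) 0 (U lam) (G lam) μ) →
          ASETendsto P
            (fun lam => regularSINR h α σ (lineLattice lam) 0 (U lam) (G lam)) L) ∧
        (∀ (X : ∀ lam, ℕ → Ω lam → ℝ) (G : ∀ lam, ℕ → Ω lam → ℝ),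
          (∀ lam, 0 < lam → IsPoissonNetwork (P lam) (X lam) (G lam) lam μ) →
          ASETendsto P (fun lam => poissonSINR h α σ (X lam) (G lam)) L)) ∧
    -- two-dimensional networks
    (2 < α → ∃ L : ℝ, L ≠ 0 ∧
      2 * √3 / (12 * Real.log 2 * h ^ 2 *
        (1 + 2 * (Real.Gamma (α - 2) / Real.Gamma (α - 1)))) ≤ L ∧
      ∀ (μ σ : ℝ), 0 < μ →
      ∀ (Ω : ℝ → Type*) [∀ lam, MeasurableSpace (Ω lam)]
        (P : ∀ lam, Measure (Ω lam)) [∀ lam, IsProbabilityMeasure (P lam)],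
        (∀ (U : ∀ lam, Ω lam → EuclideanSpace ℝ (Fin 2)) (G : ∀ lam, ℤ × ℤ → Ω lam → ℝ),
          (∀ lam, 0 < lam →
            IsRegularNetwork (P lam) (hexLattice lam) 0 (U lam) (G lam) μ) →
          ASETendsto P
            (fun lam => regularSINR h α σ (hexLattice lam) 0 (U lam) (G lam)) L) ∧
        (∀ (X : ∀ lam, ℕ → Ω lam → EuclideanSpace ℝ (Fin 2)) (G : ∀ lam, ℕ → Ω lam → ℝ),
          (∀ lam, 0 < lam → IsPoissonNetwork (P lam) (X lam) (G lam) lam μ) →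
          ASETendsto P (fun lam => poissonSINR h α σ (X lam) (G lam)) L)) := by
  have hlog : 0 < Real.log 2 := Real.log_pos one_lt_two
  constructor
  · intro hα
    have hα' : (Module.finrank ℝ ℝ : ℝ) < α := by simpa using hα
    have hK := totalLoss_pos (E := ℝ) hh hα'
    refine ⟨1 / (totalLoss ℝ h α * Real.log 2), by positivity, ?_, fun μ σ hμ Ω _ P _ =>
      ⟨fun U G hN => ?_, fun X G hN => IsPoissonNetwork.aseTendsto hh hα' hμ σ hN⟩⟩
    · have hle := totalLoss_le (E := ℝ) hh hα'
      have hball : volume.real (Metric.ball (0 : ℝ) 1) = 2 := by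
        simp [measureReal_def]
      simp only [Module.finrank_self, hball, Nat.cast_one, pow_one, one_mul, div_one] at hle
      have h1 : 0 < α - 1 := by linarith
      have hΓ : Real.Gamma (α - 1) / Real.Gamma α = 1 / (α - 1) := by
        have := Real.Gamma_add_one h1.ne'
        rw [sub_add_cancel] at this
        have hpos := Real.Gamma_pos_of_pos h1
        rw [this]
        field_simp
      rw [hΓ]
      refine one_div_le_one_div_of_le (by positivity) ?_
      calc totalLoss ℝ h α * Real.log 2 ≤ 2 * (h + h / (α - 1)) * Real.log 2 := by gcongr
        _ = _ := by ring
    · refine IsRegularNetwork.aseTendsto hh hα' hμ σ (ρ := fun lam => 1 / lam)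
        (fun lam hlam => lineLattice_isTiling hlam) (fun lam => by simp [lineLattice])
        (fun lam hlam => (one_div_pos.2 hlam).le) (fun a ha c _ hac => ?_) ?_ hN
      · exact one_div_le_one_div_of_le ha hac
      · simpa using tendsto_inv_atTop_zero (𝕜 := ℝ)
  · intro hα
    have hα' : (Module.finrank ℝ (EuclideanSpace ℝ (Fin 2)) : ℝ) < α := by simpa using hα
    have hK := totalLoss_pos (E := EuclideanSpace ℝ (Fin 2)) hh hα'
    refine ⟨1 / (totalLoss (EuclideanSpace ℝ (Fin 2)) h α * Real.log 2), by positivity, ?_,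
      fun μ σ hμ Ω _ P _ =>
      ⟨fun U G hN => ?_, fun X G hN => IsPoissonNetwork.aseTendsto hh hα' hμ σ hN⟩⟩
    · have hle := totalLoss_le (E := EuclideanSpace ℝ (Fin 2)) hh hα'
      have hball : volume.real (Metric.ball (0 : EuclideanSpace ℝ (Fin 2)) 1) = Real.pi := by
        rw [measureReal_def, EuclideanSpace.volume_ball_fin_two]
        simp [Real.pi_pos.le]
      rw [finrank_euclideanSpace_fin, hball] at hle
      push_cast at hle
      have h1 : 0 < α - 2 := by linarith
      have hΓ : Real.Gamma (α - 2) / Real.Gamma (α - 1) = 1 / (α - 2) := by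
        have := Real.Gamma_add_one h1.ne'
        rw [show α - 2 + 1 = α - 1 by ring] at this
        have hpos := Real.Gamma_pos_of_pos h1
        rw [this]
        field_simp
      rw [hΓ, div_le_div_iff₀ (by positivity) (by positivity)]
      set T := h ^ 2 * (1 + 2 * (1 / (α - 2))) with hT
      have hT0 : 0 < T := by positivity
      have hle' : totalLoss (EuclideanSpace ℝ (Fin 2)) h α ≤ Real.pi * T :=
        hle.trans_eq (by rw [hT]; ring)
      -- `2 π √3 ≤ 2 * 3.15 * 1.75 ≤ 12`
      have hpi : Real.pi * (2 * √3) ≤ 12 := by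
        have h3 : √3 ≤ 1.75 := Real.sqrt_le_iff.2 ⟨by norm_num, by norm_num⟩
        have := Real.pi_lt_d2
        nlinarith [Real.pi_pos]
      calc 2 * √3 * (totalLoss (EuclideanSpace ℝ (Fin 2)) h α * Real.log 2)
          ≤ 2 * √3 * (Real.pi * T * Real.log 2) := by gcongr
        _ = Real.pi * (2 * √3) * (T * Real.log 2) := by ring
        _ ≤ 12 * (T * Real.log 2) := by gcongr
        _ = _ := by rw [hT]; ring
    · refine IsRegularNetwork.aseTendsto hh hα' hμ σ (ρ := fun lam => 2 * hexDistance lam)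
        (fun lam hlam => hexLattice_isTiling hlam) (fun lam => ?_)
        (fun lam hlam => by have := hexDistance_pos hlam; positivity)
        (fun a ha c hc hac => mul_le_mul_of_nonneg_left (antitoneOn_hexDistance ha hc hac)
          zero_le_two) (by simpa using tendsto_hexDistance.const_mul 2) hN
      ext i
      fin_cases i <;> simp [hexLattice]
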